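/- Let $T>0$, $\alpha\in(\tfrac12,1)$, let $(\Omega,\mathcal F,\mathbb P)$ be a probability space with a filtration $\mathbb F=(\mathcal F_t)_{t\in[0,T]}$, and let $X=(X_t)_{t\in[0,T]}$ be an $\mathbb F$-adapted centered Gaussian process with continuous paths. Assume: (A) $X$ belongs to the class $\mathcal X^\alpha_T$: there is $\delta\in(0,T]$ such that for every $u\in[T-\delta,T)$ the process $Y_t=X_{t+u}-X_u$, $t\in[0,T-u]$, satisfies (times ranging over $[0,T-u]$, constants possibly depending on $u$) 1. $\mathbb E[Y_sY_t]>0$ for all $s,t>0$; 2. there is $C>0$ with $\sup_{0\le s\le T-u-t}\mathbb E[(Y_{t+s}-Y_s)^2]\le Ct^{2\alpha}$ for all $t$; 3. there are $c,\hat\delta>0$ with $\mathbb E[Y_s^2]\ge cs^2$ for $s\le\hat\delta$; 4. there is $\hat\delta>0$ with $\sup_{0<t<2\hat\delta}\ \sup_{t/2\le s\le t}\ \mathbb E[Y_s^2]/\mathbb E[Y_tY_s]<\infty$. (B) (Small balls) There are $C,\Delta>0$ and $\delta\in(0,T]$ such that for all $s<t$ in $[T-\delta,T]$ with $t-s\le\Delta$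 and all $0<\varepsilon\le(t-s)^\alpha$, $$\mathbb P\Big(\sup_{s\le u\le t}|X_u-X_s|\le\varepsilon\Big)\le\exp\big(-C(t-s)\,\varepsilon^{-1/\alpha}\big).$$ Then for every distribution function $F$ on $\mathbb R$ there is an $\mathbb F$-adapted process $\psi_T=(\psi_T(s))_{s\in[0,T]}$ such that the generalized Lebesgue–Stieltjes integral $\int_0^T\psi_T(s)\,\mathrm dX_s$ exists almost surely and has distribution function $F$. Here, for $\beta\in(0,1)$, a measurable $f:[0,T]\to\mathbb R$ with $$\int_0^T\frac{|f(s)|}{s^\beta}\,\mathrm ds+\int_0^T\!\!\int_0^s\frac{|f(u)-f(s)|}{(s-u)^{1+\beta}}\,\mathrm du\,\mathrm ds<\infty,$$ and a continuous $g:[0,T]\to\mathbb R$ for which there is $a\in[0,T)$ such that $f=0$ on $[0,a)$ and $$\sup_{a\le s<t\le T}\Big(\frac{|g(t)-g(s)|}{(t-s)^{1-\beta}}+\int_s^t\frac{|g(u)-g(s)|}{(u-s)^{2-\beta}}\,\mathrm du\Big)<\infty,$$ the generalized Lebesgue–Stieltjes integral is said to exist and is given by the absolutely convergent integral $$\int_0^T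 f\,\mathrm dg=-\int_0^T D^\beta f(s)\,D^{1-\beta}_{T-}g_{T-}(s)\,\mathrm ds,\qquad g_{T-}(s)=g(s)-g(T),$$ $$D^\beta f(s)=\frac1{\Gamma(1-\beta)}\Big(\frac{f(s)}{s^\beta}+\beta\int_0^s\frac{f(s)-f(u)}{(s-u)^{\beta+1}}\mathrm du\Big),\qquad D^{1-\beta}_{T-}h(s)=\frac1{\Gamma(\beta)}\Big(\frac{h(s)}{(T-s)^{1-\beta}}+(1-\beta)\int_s^T\frac{h(s)-h(u)}{(u-s)^{2-\beta}}\mathrm du\Big)$$ (the product vanishes for $s<a$); its value does not depend on $\beta$. One deterministic $\beta$ serves for almost all paths. -/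

import Mathlib

open Set MeasureTheory ProbabilityTheory
open scoped ENNReal

noncomputable section

namespace GaussRep

/-! ### Gaussian processes -/

section Gaussian

variable {Ω : Type*} [MeasurableSpace Ω]

/-- Covariance `R_Z(t,s) = E[Z_t Z_s]` of a centered process. -/
def covR (P : Measure Ω) (Z : ℝ → Ω → ℝ) (t s : ℝ) : ℝ := ∫ ω, Z t ω * Z s ω ∂P

/-- Incremental variance `W_Z(t,s) = E[(Z_t - Z_s)^2]`. -/
def incVar (P : Measure Ω) (Z : ℝ → Ω → ℝ) (t s : ℝ) : ℝ := ∫ ω, (Z t ω - Z s ω) ^ 2 ∂P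

/-- Variance `V_Z(t) = E[Z_t^2]`. -/
def varV (P : Measure Ω) (Z : ℝ → Ω → ℝ) (t : ℝ) : ℝ := ∫ ω, (Z t ω) ^ 2 ∂P

/-- The incremental process `Y_t = X_{t+u} - X_u`. -/
def incr (X : ℝ → Ω → ℝ) (u : ℝ) : ℝ → Ω → ℝ := fun t ω => X (t + u) ω - X u ω

/-- `X = (X_t)_{t ∈ [0,T]}` is a centered Gaussian process with continuous paths.
Only the values of `X` at times in `[0,T]` are used. -/
structure IsCenteredContGaussian (P : Measure Ω) (T : ℝ) (X : ℝ → Ω → ℝ) : Prop where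
  gaussian : IsGaussianProcess (fun t : Icc (0 : ℝ) T => X t) P
  centered : ∀ t ∈ Icc 0 T, ∫ ω, X t ω ∂P = 0
  continuous : ∀ ω, ContinuousOn (fun t => X t ω) (Icc 0 T)

/-- The covariance conditions (1)-(4) on a process `Y = (Y_t)_{t ∈ [0,L]}`. -/
structure CovConditions (P : Measure Ω) (α L : ℝ) (Y : ℝ → Ω → ℝ) : Prop where
  /-- (1) strictly positive covariance -/
  pos : ∀ s ∈ Ioc 0 L, ∀ t ∈ Ioc 0 L, 0 < covR P Y s t
  /-- (2) `w*_Y(t) = sup_{0 ≤ s ≤ L - t} W_Y(t+s,s) ≤ C t^{2α}` -/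
  upper : ∃ C > 0, ∀ t ∈ Icc 0 L, ∀ s ∈ Icc 0 (L - t), incVar P Y (t + s) s ≤ C * t ^ (2 * α)
  /-- (3) `V_Y(s) ≥ c s^2` for small `s` -/
  lower : ∃ c > 0, ∃ d > 0, ∀ s ∈ Icc 0 L, s ≤ d → c * s ^ 2 ≤ varV P Y s
  /-- (4) `sup_{0 < t < 2d} sup_{t/2 ≤ s ≤ t} R_Y(s,s) / R_Y(t,s) < ∞` -/
  ratio : ∃ d > 0, ∃ M : ℝ, ∀ t ∈ Ioc 0 L, t < 2 * d → ∀ s ∈ Icc (t / 2) t,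
    covR P Y s s / covR P Y t s ≤ M

/-- The class `𝒳^α_T`: the increments of `X` started at any time `u` close to `T` satisfy the
covariance conditions; the constants in them may depend on `u`. -/
structure InClassX (P : Measure Ω) (α T : ℝ) (X : ℝ → Ω → ℝ) : Prop where
  base : IsCenteredContGaussian P T X
  local_cov : ∃ δ > 0, δ ≤ T ∧ ∀ u ∈ Ico (T - δ) T, CovConditions P α (T - u) (incr X u)

/-- Small ball assumption near `T`: on every sufficiently short interval `[s,t]` close to `T`,
`P(sup_{s ≤ u ≤ t} |X_u - X_s| ≤ ε) ≤ exp(-C (t-s) ε^{-1/α})` provided that `ε ≤ (t-s)^α`. -/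
def SmallBall (P : Measure Ω) (α T : ℝ) (X : ℝ → Ω → ℝ) : Prop :=
  ∃ C > 0, ∃ δ > 0, ∃ Δ > 0, δ ≤ T ∧
    ∀ s ∈ Icc (T - δ) T, ∀ t ∈ Icc (T - δ) T, s < t → t - s ≤ Δ →
      ∀ ε > 0, ε ≤ (t - s) ^ α →
        P.real {ω | ∀ u ∈ Icc s t, |X u ω - X s ω| ≤ ε}
          ≤ Real.exp (-(C * (t - s) * ε ^ (-(1 / α))))

end Gaussian

/-! ### The generalized Lebesgue--Stieltjes integral -/

/-- The Besov norm `‖g‖_{1,β}` on the interval `[a,b]`, with values in `[0,∞]`. -/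
def besov1 (β a b : ℝ) (g : ℝ → ℝ) : ℝ≥0∞ :=
  ⨆ s ∈ Icc a b, ⨆ t ∈ Ioc s b,
    (ENNReal.ofReal (|g t - g s| / (t - s) ^ β)
      + ∫⁻ u in Ioo s t, ENNReal.ofReal (|g u - g s| / (u - s) ^ (1 + β)))

/-- The Besov norm `‖f‖_{2,β}` on the interval `[0,T]`, with values in `[0,∞]`. -/
def besov2 (β T : ℝ) (f : ℝ → ℝ) : ℝ≥0∞ :=
  (∫⁻ s in Ioo 0 T, ENNReal.ofReal (|f s| / s ^ β))
    + ∫⁻ s in Ioo 0 T, ∫⁻ u in Ioo 0 s, ENNReal.ofReal (|f u - f s| / (s - u) ^ (1 + β))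

/-- Left Riemann--Liouville derivative `D^β_{0+} f` in Weyl representation. -/
def weylLeft (β : ℝ) (f : ℝ → ℝ) (s : ℝ) : ℝ :=
  1 / Real.Gamma (1 - β) *
    (f s / s ^ β + β * ∫ u in Ioo 0 s, (f s - f u) / (s - u) ^ (β + 1))

/-- Right Riemann--Liouville derivative `D^β_{t-} g` in Weyl representation, without its complex
unit factor, a power of `-1`. -/
def weylRight (β t : ℝ) (g : ℝ → ℝ) (s : ℝ) : ℝ :=
  1 / Real.Gamma (1 - β) *
    (g s / (t - s) ^ β + β * ∫ u in Ioo s t, (g s - g u) / (u - s) ^ (β + 1))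

/-- The Lebesgue integral that defines the generalized Lebesgue--Stieltjes integral
`∫_0^t f dg` for an integrator `g` that is continuous at `t`. The minus sign is the product
`(-1)^β (-1)^{1-β}` of the unit factors of the fractional calculus; thus `∫_0^t 1 dg = g t - g 0`
for smooth `g`. -/
def glsValue (β t : ℝ) (f g : ℝ → ℝ) : ℝ :=
  -∫ s in Ioo 0 t, weylLeft β f s * weylRight (1 - β) t (fun r => g r - g t) s

/-- The generalized Lebesgue--Stieltjes integral `∫_0^T f dg` exists, by means of the fractional
order `β`, and equals `I`: the integrand lies in `W^β_2([0,T])`, and the integrator is continuous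
on `[0,T]` and lies in `W^{1-β}_1` on an interval `[a,T]` before which `f` vanishes (`a = 0` is
the usual case; on `[0,a)` also `D^β_{0+} f` vanishes, so that `g` plays no role there). Then
`D^{1-β}_{T-} g_{T-}` is bounded on `(a,T)`, `D^β_{0+} f` is integrable, and the defining integral
converges absolutely. -/
structure HasGLSIntegral (β T : ℝ) (f g : ℝ → ℝ) (I : ℝ) : Prop where
  order : β ∈ Ioo (0 : ℝ) 1
  measurable_integrand : Measurable (fun t : Icc 0 T => f t)
  integrand : besov2 β T f < ∞
  continuous_integrator : ContinuousOn g (Icc 0 T)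
  integrator : ∃ a ∈ Ico 0 T, (∀ s ∈ Ico 0 a, f s = 0) ∧ besov1 (1 - β) a T g < ∞
  value : glsValue β T f g = I

/-- `F` is a (cumulative) distribution function of a probability law on `ℝ`. -/
structure IsDistributionFunction (F : ℝ → ℝ) : Prop where
  mono : Monotone F
  right_cont : ∀ x, ContinuousWithinAt F (Ici x) x
  at_bot : Filter.Tendsto F Filter.atBot (nhds 0)
  at_top : Filter.Tendsto F Filter.atTop (nhds 1)

end GaussRep

end

noncomputable section

namespace GaussRep

open Filter Topology

/-! The target law is produced first, and its value is then reached by trading. On `[a, u 0]`, with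
`a = T - δ`, the increment of `X` is a nondegenerate Gaussian variable, so a quantile transform of
it is a variable `G` with distribution function `F`, known at time `u 0` (`exists_transport`). It
remains to find an adapted integrand on `(u 0, T)` whose integral is exactly `G`. Since `2α > 1`,
the quadratic variation of `X` vanishes on `[a, T]`, so Riemann sums of `2 (X - X_s) dX` over `[s,
t]` approximate `(X_t - X_s)^2`, which is almost surely positive. With a large factor and a fine
grid, the sum over the block `[u k, u (k+1)]` is at least one except on an event of probability `η
k` (`IncrementBound.exists_riemannSum`). The `η k` are summable, so by Borel–Cantelli the
accumulated gain tends to infinity along the blocks, almost surely. Trading stops when the gain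
first passes `|G|`; by continuity the gain is then exactly `|G|`, and the factor `signOne (G ω)`
turns it into `G` (`hasGLSIntegral_strategy`). The passage occurs before `T`, so each path of the
integrand is a finite step function. Its fractional integral has to be identified with the
Riemann–Stieltjes sum (`hasGLSIntegral_stepFun`). A jump at `p` has left Weyl derivative `(s -
p)^(-β) / Γ(1 - β)` for `s > p`, and integrating against this kernel is the right fractional
integral of order `1 - β`, the inverse of the right Weyl derivative on Hölder functions
(`integral_rpow_mul_weylRight`). The Hölder continuity of the paths is Kolmogorov's criterion
(`IncrementBound.ae_holder`). -/

/-! ### Power kernels and the Beta integral. -/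

lemma integrableOn_sub_rpow {a b r : ℝ} (hr : -1 < r) :
    IntegrableOn (fun s => (s - a) ^ r) (Ioo a b) := by
  rcases le_or_gt b a with h | h
  · simp [Ioo_eq_empty (not_lt.2 h)]
  have := (intervalIntegral.intervalIntegrable_rpow' (a := 0) (b := b - a) hr).comp_sub_right a
  simp only [zero_add, sub_add_cancel] at this
  rw [intervalIntegrable_iff_integrableOn_Ioo_of_le h.le] at this
  exact this

lemma integral_sub_rpow {a b r : ℝ} (h : a ≤ b) (hr : -1 < r) :
    ∫ s in Ioo a b, (s - a) ^ r = (b - a) ^ (r + 1) / (r + 1) := by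
  rw [← integral_Ioc_eq_integral_Ioo, ← intervalIntegral.integral_of_le h,
    intervalIntegral.integral_comp_sub_right (fun s => s ^ r) a, integral_rpow (Or.inl hr)]
  rw [sub_self, Real.zero_rpow (by linarith), sub_zero]

/-- The exponents add up to `-1`, so the integral is scale invariant: it is `B(l, 1 - l)` on every
interval. This independence of `a` and `u` is what makes fractional integration invert
differentiation. -/
lemma integral_beta_kernel {a u l : ℝ} (h : a < u) (hl : l ∈ Ioo (0 : ℝ) 1) :
    ∫ s in Ioo a u, (s - a) ^ (l - 1) * (u - s) ^ (-l) = Real.Gamma l * Real.Gamma (1 - l) := by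
  have h0 : 0 < u - a := sub_pos.2 h
  have e := Complex.betaIntegral_scaled (l : ℂ) ((1 - l : ℝ) : ℂ) h0
  have e1 : (l : ℂ) + ((1 - l : ℝ) : ℂ) - 1 = 0 := by push_cast; ring
  rw [e1, Complex.cpow_zero, one_mul] at e
  have e2 := Complex.Gamma_mul_Gamma_eq_betaIntegral (s := (l : ℂ)) (t := ((1 - l : ℝ) : ℂ))
    (by simpa using hl.1) (by simpa using hl.2)
  have e3 : (l : ℂ) + ((1 - l : ℝ) : ℂ) = 1 := by push_cast; ring
  rw [e3, Complex.Gamma_one, one_mul, ← e, Complex.Gamma_ofReal, Complex.Gamma_ofReal] at e2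
  have e4 : ∫ s in Ioo a u, (s - a) ^ (l - 1) * (u - s) ^ (-l)
      = ∫ s in (0 : ℝ)..(u - a), s ^ (l - 1) * ((u - a) - s) ^ (-l) := by
    rw [← integral_Ioc_eq_integral_Ioo, ← intervalIntegral.integral_of_le h.le]
    have := intervalIntegral.integral_comp_sub_right (a := a) (b := u)
      (fun s => s ^ (l - 1) * ((u - a) - s) ^ (-l)) a
    rw [sub_self] at this
    rw [← this]
    congr 1 with s
    congr 2
    ring
  rw [e4]
  have e5 : ((∫ s in (0 : ℝ)..(u - a), s ^ (l - 1) * ((u - a) - s) ^ (-l) : ℝ) : ℂ)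
      = ((Real.Gamma l * Real.Gamma (1 - l) : ℝ) : ℂ) := by
    rw [← intervalIntegral.integral_ofReal]
    push_cast at e2 ⊢
    rw [e2, intervalIntegral.integral_of_le h0.le, intervalIntegral.integral_of_le h0.le]
    refine setIntegral_congr_fun measurableSet_Ioc fun s hs => ?_
    have h1 : 0 ≤ s := hs.1.le
    have h2 : 0 ≤ u - a - s := sub_nonneg.2 hs.2
    rw [Complex.ofReal_cpow h1, Complex.ofReal_cpow h2]
    push_cast
    congr 2
    ring
  exact_mod_cast e5

lemma integrableOn_beta_kernel {a u l : ℝ} (h : a < u) (hl : l ∈ Ioo (0 : ℝ) 1) :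
    IntegrableOn (fun s => (s - a) ^ (l - 1) * (u - s) ^ (-l)) (Ioo a u) := by
  -- A non-integrable function has Bochner integral zero by convention, whereas the value just
  -- computed is positive.
  by_contra hc
  have h1 := integral_beta_kernel h hl
  rw [integral_undef hc] at h1
  have := mul_pos (Real.Gamma_pos_of_pos hl.1) (Real.Gamma_pos_of_pos (sub_pos.2 hl.2))
  linarith

/-- Fubini on the triangle `a < s < u < T` for the kernel of the Beta integral. -/
lemma integral_triangle_beta {a T l : ℝ} (hl : l ∈ Ioo (0 : ℝ) 1) {f : ℝ → ℝ}
    (hf : IntegrableOn f (Ioo a T)) :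
    ∫ s in Ioo a T, (s - a) ^ (l - 1) * ∫ u in Ioo s T, f u * (u - s) ^ (-l)
      = Real.Gamma l * Real.Gamma (1 - l) * ∫ u in Ioo a T, f u := by
  -- The indicator carries the condition `a < s < u`, so that both variables range over the fixed
  -- interval `(a, T)` and the order of integration can be exchanged.
  let K : ℝ → ℝ → ℝ := fun s u =>
    (Ioo a u).indicator (fun s => (s - a) ^ (l - 1) * (u - s) ^ (-l)) s
  have hK : Measurable (fun z : ℝ × ℝ => K z.1 z.2) := by
    have : (fun z : ℝ × ℝ => K z.1 z.2) = {z : ℝ × ℝ | a < z.1 ∧ z.1 < z.2}.indicator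
        (fun z => (z.1 - a) ^ (l - 1) * (z.2 - z.1) ^ (-l)) := by
      ext z
      simp [K, indicator_apply]
    rw [this]
    refine Measurable.indicator (by fun_prop) ?_
    exact (measurableSet_lt measurable_const measurable_fst).inter
      (measurableSet_lt measurable_fst measurable_snd)
  have hKn : ∀ s u, 0 ≤ K s u := by
    intro s u
    refine indicator_nonneg (fun x hx => ?_) s
    exact mul_nonneg (Real.rpow_nonneg (by linarith [hx.1]) _)
      (Real.rpow_nonneg (by linarith [hx.2]) _)
  have hsub : ∀ u ∈ Ioo a T, Ioo a T ∩ Ioo a u = Ioo a u := fun u hu =>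
    inter_eq_right.2 (Ioo_subset_Ioo_right hu.2.le)
  have hKi : ∀ u ∈ Ioo a T, IntegrableOn (fun s => K s u) (Ioo a T) := by
    intro u hu
    rw [IntegrableOn, integrable_indicator_iff measurableSet_Ioo, IntegrableOn,
      Measure.restrict_restrict measurableSet_Ioo, inter_comm, hsub u hu]
    exact integrableOn_beta_kernel hu.1 hl
  have hKe : ∀ u ∈ Ioo a T, ∫ s in Ioo a T, K s u = Real.Gamma l * Real.Gamma (1 - l) := by
    intro u hu
    rw [setIntegral_indicator measurableSet_Ioo, hsub u hu]
    exact integral_beta_kernel hu.1 hl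
  have hint : Integrable (Function.uncurry fun s u => f u * K s u)
      ((volume.restrict (Ioo a T)).prod (volume.restrict (Ioo a T))) := by
    have hm : AEStronglyMeasurable (Function.uncurry fun s u => f u * K s u)
      ((volume.restrict (Ioo a T)).prod (volume.restrict (Ioo a T))) :=
      (hf.aestronglyMeasurable.comp_snd).mul hK.aestronglyMeasurable
    rw [integrable_prod_iff' hm]
    constructor
    · refine (ae_restrict_iff' measurableSet_Ioo).2 (ae_of_all _ fun u hu => ?_)
      exact (hKi u hu).const_mul (f u)
    · have : ∀ u ∈ Ioo a T, ∫ s in Ioo a T, ‖Function.uncurry (fun s u => f u * K s u) (s, u)‖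
          = ‖f u‖ * (Real.Gamma l * Real.Gamma (1 - l)) := by
        intro u hu
        simp only [Function.uncurry_apply_pair, norm_mul, Real.norm_of_nonneg (hKn _ _)]
        rw [integral_const_mul, hKe u hu]
      refine (integrableOn_congr_fun this measurableSet_Ioo).2 ?_
      exact hf.norm.mul_const _
  have hswap := integral_integral_swap hint
  have hl1 : ∫ s in Ioo a T, (s - a) ^ (l - 1) * ∫ u in Ioo s T, f u * (u - s) ^ (-l)
      = ∫ s in Ioo a T, ∫ u in Ioo a T, f u * K s u := by
    refine setIntegral_congr_fun measurableSet_Ioo fun s hs => ?_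
    have : ∀ u, f u * K s u
        = (Ioi s).indicator (fun u => (s - a) ^ (l - 1) * (f u * (u - s) ^ (-l))) u := by
      intro u
      by_cases hu : s < u
      · simp [K, indicator_apply, hu, hs.1]; ring
      · simp [K, indicator_apply, hu]
    simp_rw [this]
    rw [setIntegral_indicator measurableSet_Ioi, ← integral_const_mul]
    congr 2
    ext u
    simp only [mem_Ioo, mem_inter_iff, mem_Ioi]
    constructor
    · rintro ⟨h1, h2⟩; exact ⟨⟨hs.1.trans h1, h2⟩, h1⟩
    · rintro ⟨⟨_, h2⟩, h1⟩; exact ⟨h1, h2⟩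
  rw [hl1, hswap, ← integral_const_mul]
  refine setIntegral_congr_fun measurableSet_Ioo fun u hu => ?_
  rw [integral_const_mul, hKe u hu, mul_comm]

/-! ### Right Weyl derivatives and their inversion. -/

lemma abs_sub_mul_rpow_le {K γ p : ℝ} {h : ℝ → ℝ}
    (hh : ∀ x y, |h x - h y| ≤ K * |x - y| ^ γ) {s u : ℝ} (hs : s < u) :
    |(h s - h u) / (u - s) ^ p| ≤ K * (u - s) ^ (γ - p) := by
  have h0 : 0 < u - s := sub_pos.2 hs
  rw [abs_div, abs_of_pos (Real.rpow_pos_of_pos h0 _), div_le_iff₀ (Real.rpow_pos_of_pos h0 _),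
    mul_assoc, ← Real.rpow_add h0, sub_add_cancel]
  have := hh s u
  rwa [abs_sub_comm s u, abs_of_pos h0] at this

lemma continuous_of_holder {K γ : ℝ} (hγ : 0 < γ) {h : ℝ → ℝ}
    (hh : ∀ x y, |h x - h y| ≤ K * |x - y| ^ γ) : Continuous h := by
  rw [continuous_iff_continuousAt]
  intro x
  rw [ContinuousAt, tendsto_iff_dist_tendsto_zero]
  have h1 : Tendsto (fun y => K * |y - x| ^ γ) (𝓝 x) (𝓝 0) := by
    have : Continuous fun y => K * |y - x| ^ γ :=
      continuous_const.mul ((continuous_id.sub continuous_const).abs.rpow_const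
        fun _ => Or.inr hγ.le)
    have := this.tendsto x
    simpa [Real.zero_rpow hγ.ne'] using this
  exact squeeze_zero (fun _ => dist_nonneg) (fun y => hh y x) h1

lemma integrableOn_holder_kernel {K γ l s t : ℝ} (hl : 0 < l) (hγ : l < γ) {h : ℝ → ℝ}
    (hh : ∀ x y, |h x - h y| ≤ K * |x - y| ^ γ) :
    IntegrableOn (fun u => (h s - h u) / (u - s) ^ (l + 1)) (Ioo s t) := by
  have hc := (continuous_of_holder (hl.trans hγ) hh).measurable
  refine Integrable.mono' ((integrableOn_sub_rpow (a := s) (b := t)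
    (r := γ - (l + 1)) (by linarith)).const_mul K)
    (Measurable.aestronglyMeasurable (by fun_prop)) ?_
  refine (ae_restrict_iff' measurableSet_Ioo).2 (ae_of_all _ fun u hu => ?_)
  exact abs_sub_mul_rpow_le hh hu.1

/-- Weyl derivative of a `C^1` function vanishing at the right end point. -/
lemma weylRight_of_hasDerivAt {l T s : ℝ} (hl : l ∈ Ioo (0 : ℝ) 1) {h h' : ℝ → ℝ}
    {K γ : ℝ} (hγ : l < γ) (hh : ∀ x y, |h x - h y| ≤ K * |x - y| ^ γ)
    (hd : ∀ x, HasDerivAt h (h' x) x) (hc : Continuous h') (hT : h T = 0) (hs : s < T) :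
    weylRight l T h s = 1 / Real.Gamma (1 - l) * ∫ u in Ioo s T, (-h' u) * (u - s) ^ (-l) := by
  have hi1 := integrableOn_holder_kernel (s := s) (t := T) hl.1 hγ hh
  have hi2 : IntegrableOn (fun u => (-h' u) * (u - s) ^ (-l)) (Ioo s T) := by
    have := integrableOn_sub_rpow (a := s) (b := T) (r := -l) (by linarith [hl.2])
    obtain ⟨M, hM⟩ := isCompact_Icc.exists_bound_of_continuousOn (hc.neg.continuousOn (s := Icc s T))
    refine Integrable.bdd_mul (c := M) this hc.neg.aestronglyMeasurable ?_
    refine (ae_restrict_iff' measurableSet_Ioo).2 (ae_of_all _ fun u hu => ?_)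
    exact hM u (Ioo_subset_Icc_self hu)
  -- Integration by parts: the primitive is `(h s - h u) (u - s)^(-l)`, continuous down to `u = s`
  -- because `l < γ`. Its value at `T`, where `h` vanishes, is the boundary term of the Weyl
  -- derivative.
  have hφ : ∫ u in s..T, ((-h' u) * (u - s) ^ (-l) - l * ((h s - h u) / (u - s) ^ (l + 1)))
      = (h s - h T) * (T - s) ^ (-l) - (h s - h s) * (s - s) ^ (-l) := by
    refine intervalIntegral.integral_eq_sub_of_hasDerivAt_of_le hs.le ?_ ?_ ?_
      (f := fun u => (h s - h u) * (u - s) ^ (-l))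
    · have hcont := continuous_of_holder (hl.1.trans hγ) hh
      intro u hu
      rcases hu.1.eq_or_lt with rfl | hu1
      · rw [ContinuousWithinAt, sub_self, zero_mul]
        have h1 : Tendsto (fun y => K * |y - s| ^ (γ - l)) (𝓝[Icc s T] s) (𝓝 0) := by
          have h2 : Continuous fun y => K * |y - s| ^ (γ - l) :=
            continuous_const.mul ((continuous_id.sub continuous_const).abs.rpow_const
              fun _ => Or.inr (sub_nonneg.2 hγ.le))
          have h3 := (h2.tendsto s).mono_left (nhdsWithin_le_nhds (s := Icc s T))
          simpa [Real.zero_rpow (sub_pos.2 hγ).ne'] using h3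
        refine squeeze_zero_norm' ?_ h1
        filter_upwards [self_mem_nhdsWithin] with y hy
        rcases hy.1.eq_or_lt with rfl | hy1
        · simp [Real.zero_rpow (sub_pos.2 hγ).ne']
        · have h4 := abs_sub_mul_rpow_le (p := l) hh hy1
          rw [div_eq_mul_inv, ← Real.rpow_neg (sub_pos.2 hy1).le] at h4
          rwa [Real.norm_eq_abs, abs_of_pos (sub_pos.2 hy1)]
      · refine ContinuousAt.continuousWithinAt ?_
        exact (continuous_const.sub hcont).continuousAt.mul
          ((continuous_id.sub continuous_const).continuousAt.rpow_const
            (Or.inl (sub_pos.2 hu1).ne'))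
    · intro u hu
      have h0 : 0 < u - s := sub_pos.2 hu.1
      have := ((hd u).const_sub (h s)).mul
        (((hasDerivAt_id u).sub_const s).rpow_const (p := -l) (Or.inl h0.ne'))
      refine this.congr_deriv ?_
      simp only [id_eq]
      rw [show -l - 1 = -(l + 1) by ring, Real.rpow_neg h0.le (l + 1)]
      ring
    · rw [intervalIntegrable_iff_integrableOn_Ioo_of_le hs.le]
      exact hi2.sub (hi1.const_mul l)
  rw [intervalIntegral.integral_of_le hs.le, integral_Ioc_eq_integral_Ioo,
    integral_sub hi2 (hi1.const_mul l), integral_const_mul, hT, Real.rpow_neg (sub_pos.2 hs).le] at hφ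
  rw [weylRight]
  congr 1
  simp only [sub_self, zero_mul, sub_zero] at hφ
  rw [div_eq_mul_inv]
  linarith

lemma measurable_weylRight {l T : ℝ} {h : ℝ → ℝ} (hm : Measurable h) :
    Measurable (weylRight l T h) := by
  have h1 : Measurable fun s => ∫ u in Ioo s T, (h s - h u) / (u - s) ^ (l + 1) := by
    have : ∀ s, ∫ u in Ioo s T, (h s - h u) / (u - s) ^ (l + 1)
        = ∫ u, {z : ℝ × ℝ | z.1 < z.2 ∧ z.2 < T}.indicator
          (fun z => (h z.1 - h z.2) / (z.2 - z.1) ^ (l + 1)) (s, u) := by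
      intro s
      rw [← integral_indicator measurableSet_Ioo]
      rfl
    simp_rw [this]
    refine StronglyMeasurable.measurable (StronglyMeasurable.integral_prod_right' ?_)
    refine Measurable.stronglyMeasurable (Measurable.indicator (by fun_prop) ?_)
    exact (measurableSet_lt measurable_fst measurable_snd).inter
      (measurableSet_lt measurable_snd measurable_const)
  unfold weylRight
  fun_prop

/-- The bound depends on `h` only through its Hölder data, so it dominates a whole sequence of
approximations at once. -/
lemma abs_weylRight_le {l T a s : ℝ} (hl : l ∈ Ioo (0 : ℝ) 1) {h : ℝ → ℝ}
    {K γ : ℝ} (hK : 0 ≤ K) (hγ : l < γ) (hh : ∀ x y, |h x - h y| ≤ K * |x - y| ^ γ)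
    (hT : h T = 0) (hs : s ∈ Ioo a T) :
    |weylRight l T h s| ≤ 1 / Real.Gamma (1 - l) *
      (K * (T - a) ^ (γ - l) + l * (K * ((T - a) ^ (γ - l) / (γ - l)))) := by
  have hG := Real.Gamma_pos_of_pos (sub_pos.2 hl.2)
  have hle : (T - s) ^ (γ - l) ≤ (T - a) ^ (γ - l) :=
    Real.rpow_le_rpow (by linarith [hs.2]) (by linarith [hs.1]) (by linarith)
  rw [weylRight, abs_mul, abs_of_pos (one_div_pos.2 hG)]
  refine mul_le_mul_of_nonneg_left ?_ (one_div_pos.2 hG).le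
  refine (abs_add_le _ _).trans (add_le_add ?_ ?_)
  · have := abs_sub_mul_rpow_le (p := l) hh hs.2
    rw [hT, sub_zero] at this
    exact this.trans (mul_le_mul_of_nonneg_left hle hK)
  · rw [abs_mul, abs_of_pos hl.1]
    refine mul_le_mul_of_nonneg_left ?_ hl.1.le
    have h1 : |∫ u in Ioo s T, (h s - h u) / (u - s) ^ (l + 1)|
        ≤ ∫ u in Ioo s T, K * (u - s) ^ (γ - (l + 1)) := by
      have hi : IntegrableOn (fun u => K * (u - s) ^ (γ - (l + 1))) (Ioo s T) :=
        (integrableOn_sub_rpow (by linarith)).const_mul K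
      rw [← Real.norm_eq_abs]
      refine norm_integral_le_of_norm_le hi ?_
      refine (ae_restrict_iff' measurableSet_Ioo).2 (ae_of_all _ fun u hu => ?_)
      exact abs_sub_mul_rpow_le hh hu.1
    rw [integral_const_mul, integral_sub_rpow hs.2.le (by linarith)] at h1
    rw [show γ - (l + 1) + 1 = γ - l by ring] at h1
    refine h1.trans (mul_le_mul_of_nonneg_left ?_ hK)
    exact div_le_div_of_nonneg_right hle (by linarith)

/-- The right fractional integral inverts the Weyl derivative, smooth case. -/
lemma integral_rpow_mul_weylRight_of_hasDerivAt {a l T : ℝ} (hl : l ∈ Ioo (0 : ℝ) 1)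
    {h h' : ℝ → ℝ} {K γ : ℝ} (hγ : l < γ) (hh : ∀ x y, |h x - h y| ≤ K * |x - y| ^ γ)
    (hd : ∀ x, HasDerivAt h (h' x) x) (hc : Continuous h') (hT : h T = 0) (ha : a < T) :
    ∫ s in Ioo a T, (s - a) ^ (l - 1) * weylRight l T h s = Real.Gamma l * h a := by
  have hG := Real.Gamma_pos_of_pos (sub_pos.2 hl.2)
  have e1 : ∫ s in Ioo a T, (s - a) ^ (l - 1) * weylRight l T h s
      = ∫ s in Ioo a T, 1 / Real.Gamma (1 - l) *
        ((s - a) ^ (l - 1) * ∫ u in Ioo s T, (-h' u) * (u - s) ^ (-l)) := by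
    refine setIntegral_congr_fun measurableSet_Ioo fun s hs => ?_
    rw [weylRight_of_hasDerivAt hl hγ hh hd hc hT hs.2]
    ring
  have e2 : ∫ u in Ioo a T, -h' u = h a := by
    rw [integral_neg, ← integral_Ioc_eq_integral_Ioo, ← intervalIntegral.integral_of_le ha.le,
      intervalIntegral.integral_eq_sub_of_hasDerivAt (fun x _ => hd x)
        (hc.intervalIntegrable _ _), hT]
    ring
  have hi : IntegrableOn (fun u => -h' u) (Ioo a T) :=
    (hc.neg.continuousOn.integrableOn_Icc).mono_set Ioo_subset_Icc_self
  rw [e1, integral_const_mul, integral_triangle_beta hl hi, e2]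
  field_simp

/-! ### Smoothing, and inversion for Hölder functions. -/

/-- Moving averages of a Hölder function. -/
def movAvg (ε : ℝ) (h : ℝ → ℝ) (x : ℝ) : ℝ := ε⁻¹ * ∫ v in x..(x + ε), h v

lemma movAvg_eq (ε : ℝ) (h : ℝ → ℝ) (x : ℝ) : movAvg ε h x = ε⁻¹ * ∫ v in 0..ε, h (x + v) := by
  rw [movAvg, intervalIntegral.integral_comp_add_left (fun v => h v) x, add_zero]

lemma hasDerivAt_movAvg {ε : ℝ} {h : ℝ → ℝ} (hc : Continuous h) (x : ℝ) :
    HasDerivAt (movAvg ε h) (ε⁻¹ * (h (x + ε) - h x)) x := by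
  have h1 : ∀ y, ∫ v in y..(y + ε), h v = (∫ v in 0..(y + ε), h v) - ∫ v in 0..y, h v := fun y =>
    (intervalIntegral.integral_interval_sub_left (hc.intervalIntegrable _ _)
      (hc.intervalIntegrable _ _)).symm
  have h2 : ∀ y, HasDerivAt (fun y => ∫ v in 0..y, h v) (h y) y := fun y =>
    intervalIntegral.integral_hasDerivAt_right (hc.intervalIntegrable _ _)
      (hc.stronglyMeasurableAtFilter _ _) hc.continuousAt
  unfold movAvg
  simp_rw [h1]
  exact (((h2 (x + ε)).comp_add_const x ε).sub (h2 x)).const_mul ε⁻¹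

/-- An average of translates keeps the constant and the exponent, so the smoothed functions satisfy
all estimates uniformly in `ε`. -/
lemma abs_movAvg_sub_le {ε K γ : ℝ} (hε : 0 < ε) {h : ℝ → ℝ} (hc : Continuous h)
    (hh : ∀ x y, |h x - h y| ≤ K * |x - y| ^ γ) (x y : ℝ) :
    |movAvg ε h x - movAvg ε h y| ≤ K * |x - y| ^ γ := by
  rw [movAvg_eq, movAvg_eq, ← mul_sub, ← intervalIntegral.integral_sub
    (Continuous.intervalIntegrable (by fun_prop) _ _)
    (Continuous.intervalIntegrable (by fun_prop) _ _), abs_mul, abs_of_pos (inv_pos.2 hε),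
    inv_mul_le_iff₀ hε]
  have := intervalIntegral.norm_integral_le_of_norm_le_const (a := 0) (b := ε)
    (f := fun v => h (x + v) - h (y + v)) (C := K * |x - y| ^ γ) (fun v _ => by
      simpa using hh (x + v) (y + v))
  rw [sub_zero, abs_of_pos hε] at this
  rwa [mul_comm ε]

lemma abs_movAvg_sub_self_le {ε K γ : ℝ} (hε : 0 < ε) (hK : 0 ≤ K) (hγ : 0 < γ) {h : ℝ → ℝ}
    (hh : ∀ x y, |h x - h y| ≤ K * |x - y| ^ γ) (x : ℝ) :
    |movAvg ε h x - h x| ≤ K * ε ^ γ := by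
  have hc := continuous_of_holder hγ hh
  have e : h x = ε⁻¹ * ∫ v in (0 : ℝ)..ε, h x := by
    rw [intervalIntegral.integral_const]
    simp only [sub_zero, smul_eq_mul]
    field_simp
  rw [e, movAvg_eq, ← mul_sub, ← intervalIntegral.integral_sub
    (Continuous.intervalIntegrable (by fun_prop) _ _)
    (Continuous.intervalIntegrable (by fun_prop) _ _), abs_mul, abs_of_pos (inv_pos.2 hε),
    inv_mul_le_iff₀ hε]
  have := intervalIntegral.norm_integral_le_of_norm_le_const (a := 0) (b := ε)
    (f := fun v => h (x + v) - h x) (C := K * ε ^ γ) (fun v hv => by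
      rw [uIoc_of_le hε.le] at hv
      refine (hh (x + v) x).trans (mul_le_mul_of_nonneg_left ?_ hK)
      rw [add_sub_cancel_left]
      refine Real.rpow_le_rpow (abs_nonneg _) ?_ hγ.le
      rw [abs_of_pos hv.1]
      exact hv.2)
  rw [sub_zero, abs_of_pos hε] at this
  rwa [mul_comm ε]

/-- The right fractional integral inverts the Weyl derivative of a Hölder function. -/
theorem integral_rpow_mul_weylRight {a l T : ℝ} (hl : l ∈ Ioo (0 : ℝ) 1)
    {h : ℝ → ℝ} {K γ : ℝ} (hK : 0 ≤ K) (hγ : l < γ)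
    (hh : ∀ x y, |h x - h y| ≤ K * |x - y| ^ γ) (hT : ∀ x, T ≤ x → h x = 0) (ha : a < T) :
    ∫ s in Ioo a T, (s - a) ^ (l - 1) * weylRight l T h s = Real.Gamma l * h a := by
  have hγ0 : 0 < γ := hl.1.trans hγ
  have hcont := continuous_of_holder hγ0 hh
  let ε : ℕ → ℝ := fun n => 1 / ((n : ℝ) + 1)
  have hε : ∀ n, 0 < ε n := fun n => Nat.one_div_pos_of_nat
  have hε0 : Tendsto ε atTop (𝓝 0) := tendsto_one_div_add_atTop_nhds_zero_nat
  let H : ℕ → ℝ → ℝ := fun n => movAvg (ε n) h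
  have hH : ∀ n x y, |H n x - H n y| ≤ K * |x - y| ^ γ := fun n => abs_movAvg_sub_le (hε n) hcont hh
  have hHc : ∀ n, Continuous (H n) := fun n => continuous_of_holder hγ0 (hH n)
  -- The averages look forward in time; this is why `h` has to vanish on all of `[T, ∞)` and not
  -- only at `T`.
  have hHT : ∀ n, H n T = 0 := by
    intro n
    simp only [H, movAvg_eq]
    rw [intervalIntegral.integral_congr (g := fun _ => (0 : ℝ))]
    · simp
    · intro v hv
      rw [uIcc_of_le (hε n).le] at hv
      exact hT _ (by linarith [hv.1])
  have hlim : ∀ x, Tendsto (fun n => H n x) atTop (𝓝 (h x)) := by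
    intro x
    rw [tendsto_iff_dist_tendsto_zero]
    refine squeeze_zero (fun _ => dist_nonneg)
      (fun n => abs_movAvg_sub_self_le (hε n) hK hγ0 hh x) ?_
    have := (hε0.rpow_const (p := γ) (Or.inr hγ0.le)).const_mul K
    rwa [Real.zero_rpow hγ0.ne', mul_zero] at this
  have hW : ∀ s ∈ Ioo a T, Tendsto (fun n => weylRight l T (H n) s) atTop
      (𝓝 (weylRight l T h s)) := by
    intro s hs
    unfold weylRight
    refine Tendsto.const_mul _ (((hlim s).div_const _).add (Tendsto.const_mul _ ?_))
    refine tendsto_integral_of_dominated_convergence (fun u => K * (u - s) ^ (γ - (l + 1)))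
      (fun n => ?_) ((integrableOn_sub_rpow (by linarith)).const_mul K) (fun n => ?_) ?_
    · exact (integrableOn_holder_kernel hl.1 hγ (hH n)).aestronglyMeasurable
    · refine (ae_restrict_iff' measurableSet_Ioo).2 (ae_of_all _ fun u hu => ?_)
      exact abs_sub_mul_rpow_le (hH n) hu.1
    · exact ae_of_all _ fun u => ((hlim s).sub (hlim u)).div_const _
  have hn : ∀ n, ∫ s in Ioo a T, (s - a) ^ (l - 1) * weylRight l T (H n) s
      = Real.Gamma l * H n a := fun n =>
    integral_rpow_mul_weylRight_of_hasDerivAt hl hγ (hH n) (hasDerivAt_movAvg hcont)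
      (by fun_prop) (hHT n) ha
  have h1 : Tendsto (fun n => ∫ s in Ioo a T, (s - a) ^ (l - 1) * weylRight l T (H n) s) atTop
      (𝓝 (∫ s in Ioo a T, (s - a) ^ (l - 1) * weylRight l T h s)) := by
    refine tendsto_integral_of_dominated_convergence (fun s => (s - a) ^ (l - 1) *
      (1 / Real.Gamma (1 - l) *
      (K * (T - a) ^ (γ - l) + l * (K * ((T - a) ^ (γ - l) / (γ - l))))))
      (fun n => ?_) ((integrableOn_sub_rpow (by linarith [hl.1])).mul_const _) (fun n => ?_) ?_
    · have := measurable_weylRight (l := l) (T := T) (hHc n).measurable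
      exact Measurable.aestronglyMeasurable (by fun_prop)
    · refine (ae_restrict_iff' measurableSet_Ioo).2 (ae_of_all _ fun s hs => ?_)
      rw [norm_mul, Real.norm_of_nonneg (Real.rpow_nonneg (by linarith [hs.1]) _)]
      exact mul_le_mul_of_nonneg_left (abs_weylRight_le hl hK hγ (hH n) (hHT n) hs)
        (Real.rpow_nonneg (by linarith [hs.1]) _)
    · refine (ae_restrict_iff' measurableSet_Ioo).2 (ae_of_all _ fun s hs => ?_)
      exact (hW s hs).const_mul _
  simp_rw [hn] at h1
  exact tendsto_nhds_unique h1 ((hlim a).const_mul _)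

/-! ### Left Weyl derivatives of step functions. -/

/-- The jump function `t ↦ 1_{p < t}`. -/
def jump (p t : ℝ) : ℝ := if p < t then 1 else 0

lemma measurable_jump (p : ℝ) : Measurable (jump p) :=
  Measurable.ite measurableSet_Ioi measurable_const measurable_const

lemma jump_nonneg (p t : ℝ) : 0 ≤ jump p t := by
  unfold jump; split_ifs <;> norm_num

lemma jump_le_one (p t : ℝ) : jump p t ≤ 1 := by
  unfold jump; split_ifs <;> norm_num

/-- The singular kernel of a jump at `p`, as seen from `s`. -/
lemma jump_kernel_eq {p s : ℝ} (β : ℝ) :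
    ∀ u ∈ Ioo 0 s, (jump p s - jump p u) / (s - u) ^ (β + 1)
      = if p < s then (Iic p).indicator (fun u => (s - u) ^ (-(β + 1))) u else 0 := by
  intro u hu
  have hn := Real.rpow_neg (sub_pos.2 hu.2).le (β + 1)
  by_cases h1 : p < s
  · by_cases h2 : p < u
    · simp [jump, h1, h2]
    · simp only [jump, h1, h2, if_true, if_false, sub_zero, one_div, indicator_apply, mem_Iic,
        not_lt.1 h2, hn]
  · have h2 : ¬ p < u := fun h => h1 (h.trans hu.2)
    simp [jump, h1, h2]

lemma Ioo_inter_Iic_eq {p s : ℝ} (h : p < s) : Ioo 0 s ∩ Iic p = Ioc 0 p := by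
  ext u
  simp only [mem_inter_iff, mem_Ioo, mem_Iic, mem_Ioc]
  exact ⟨fun ⟨⟨h1, _⟩, h2⟩ => ⟨h1, h2⟩, fun ⟨h1, h2⟩ => ⟨⟨h1, h2.trans_lt h⟩, h2⟩⟩

lemma integrableOn_jump_kernel (p s β : ℝ) :
    IntegrableOn (fun u => (jump p s - jump p u) / (s - u) ^ (β + 1)) (Ioo 0 s) := by
  rw [integrableOn_congr_fun (jump_kernel_eq β) measurableSet_Ioo]
  by_cases h : p < s
  · simp only [h, if_true]
    rw [IntegrableOn, integrable_indicator_iff measurableSet_Iic, IntegrableOn,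
      Measure.restrict_restrict measurableSet_Iic, inter_comm, Ioo_inter_Iic_eq h]
    refine (ContinuousOn.integrableOn_Icc ?_).mono_set Ioc_subset_Icc_self
    intro u hu
    exact ((continuousAt_const.sub continuousAt_id).rpow_const
      (Or.inl (by simp only [id]; linarith [hu.2] : s - id u ≠ 0))).continuousWithinAt
  · simp [h]

/-- Only `u ≤ p < s` contributes, which leaves an elementary power integral over `(0, p]`. -/
lemma integral_jump_kernel {β p s : ℝ} (hβ : 0 < β) (hp : 0 ≤ p) :
    ∫ u in Ioo 0 s, (jump p s - jump p u) / (s - u) ^ (β + 1)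
      = jump p s * (((s - p) ^ (-β) - s ^ (-β)) / β) := by
  rw [setIntegral_congr_fun measurableSet_Ioo (jump_kernel_eq β)]
  by_cases h : p < s
  · simp only [h, if_true, jump, one_mul]
    rw [setIntegral_indicator measurableSet_Iic, Ioo_inter_Iic_eq h,
      ← intervalIntegral.integral_of_le hp,
      intervalIntegral.integral_comp_sub_left (fun x => x ^ (-(β + 1))) s, integral_rpow]
    · rw [sub_zero, show -(β + 1) + 1 = -β by ring, div_neg, ← neg_div, neg_sub]
    · right
      refine ⟨by linarith, ?_⟩
      rw [uIcc_of_le (by linarith)]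
      rintro ⟨h1, _⟩
      linarith
  · simp [h, jump]

section Steps

variable {ι : Type*} (S : Finset ι) (c p : ι → ℝ)

/-- Finite linear combination of jump functions. -/
def stepFun (t : ℝ) : ℝ := ∑ i ∈ S, c i * jump (p i) t

lemma measurable_stepFun : Measurable (stepFun S c p) :=
  Finset.measurable_fun_sum _ fun i _ => (measurable_jump (p i)).const_mul (c i)

/-- The term `-s^(-β)` of `integral_jump_kernel` cancels the term `f s / s^β` of the Weyl
derivative; each jump contributes a pure power singularity at its own location. -/
lemma weylLeft_stepFun {β s : ℝ} (hβ : 0 < β) (hp : ∀ i ∈ S, 0 ≤ p i) (hs : 0 < s) :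
    weylLeft β (stepFun S c p) s
      = ∑ i ∈ S, 1 / Real.Gamma (1 - β) * c i * (jump (p i) s * (s - p i) ^ (-β)) := by
  have h1 : ∀ u, (stepFun S c p s - stepFun S c p u) / (s - u) ^ (β + 1)
      = ∑ i ∈ S, c i * ((jump (p i) s - jump (p i) u) / (s - u) ^ (β + 1)) := by
    intro u
    rw [stepFun, stepFun, ← Finset.sum_sub_distrib, Finset.sum_div]
    refine Finset.sum_congr rfl fun i _ => ?_
    ring
  rw [weylLeft]
  simp_rw [h1]
  rw [integral_finsetSum _ fun i _ => (integrableOn_jump_kernel _ _ β).const_mul _,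
    stepFun, Finset.sum_div, Finset.mul_sum, ← Finset.sum_add_distrib, Finset.mul_sum]
  refine Finset.sum_congr rfl fun i hi => ?_
  rw [integral_const_mul, integral_jump_kernel hβ (hp i hi), Real.rpow_neg hs.le]
  field_simp
  ring

lemma abs_stepFun_le (t : ℝ) : |stepFun S c p t| ≤ ∑ i ∈ S, |c i| := by
  refine (Finset.abs_sum_le_sum_abs _ _).trans (Finset.sum_le_sum fun i _ => ?_)
  rw [abs_mul, abs_of_nonneg (jump_nonneg _ _)]
  exact mul_le_of_le_one_right (abs_nonneg _) (jump_le_one _ _)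

/-- The inner integral of a jump at `p` is at most `(s - p)^(-β) / β`, which is integrable in `s`
because `β < 1`. -/
lemma besov2_stepFun_lt_top {β : ℝ} (hβ : β ∈ Ioo (0 : ℝ) 1) (T : ℝ) (hp : ∀ i ∈ S, 0 ≤ p i) :
    besov2 β T (stepFun S c p) < ∞ := by
  have hk : ∀ q b : ℝ, IntegrableOn (fun s => (s - q) ^ (-β)) (Ioo q b) := fun q b =>
    integrableOn_sub_rpow (by linarith [hβ.2])
  refine ENNReal.add_lt_top.2 ⟨?_, ?_⟩
  · have h1 : IntegrableOn (fun s => (∑ i ∈ S, |c i|) * s ^ (-β)) (Ioo 0 T) := by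
      have := (hk 0 T).const_mul (∑ i ∈ S, |c i|)
      simp only [sub_zero] at this
      exact this
    refine lt_of_le_of_lt (setLIntegral_mono' measurableSet_Ioo fun s hs => ?_)
      h1.setLIntegral_lt_top
    refine ENNReal.ofReal_le_ofReal ?_
    rw [Real.rpow_neg hs.1.le, ← div_eq_mul_inv]
    exact div_le_div_of_nonneg_right (abs_stepFun_le S c p s) (Real.rpow_nonneg hs.1.le _)
  · have h2 : ∀ s ∈ Ioo 0 T,
        ∫⁻ u in Ioo 0 s, ENNReal.ofReal (|stepFun S c p u - stepFun S c p s| / (s - u) ^ (1 + β))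
        ≤ ENNReal.ofReal (∑ i ∈ S, |c i| * (jump (p i) s * ((s - p i) ^ (-β) / β))) := by
      intro s hs
      have hi : IntegrableOn (fun u => ∑ i ∈ S,
          |c i| * ((jump (p i) s - jump (p i) u) / (s - u) ^ (β + 1))) (Ioo 0 s) :=
        integrable_finsetSum _ fun i _ => (integrableOn_jump_kernel _ _ β).const_mul _
      have hn : ∀ u ∈ Ioo 0 s, ∀ i, 0 ≤ (jump (p i) s - jump (p i) u) := by
        intro u hu i
        unfold jump
        split_ifs with h1 h2 h2
        · norm_num
        · norm_num
        · exact absurd (h2.trans hu.2) h1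
        · norm_num
      have hle : ∀ u ∈ Ioo 0 s, |stepFun S c p u - stepFun S c p s| / (s - u) ^ (1 + β)
          ≤ ∑ i ∈ S, |c i| * ((jump (p i) s - jump (p i) u) / (s - u) ^ (β + 1)) := by
        intro u hu
        rw [add_comm 1 β]
        simp_rw [mul_div_assoc']
        rw [← Finset.sum_div]
        refine div_le_div_of_nonneg_right ?_ (Real.rpow_nonneg (by linarith [hu.2]) _)
        rw [abs_sub_comm, stepFun, stepFun, ← Finset.sum_sub_distrib]
        refine (Finset.abs_sum_le_sum_abs _ _).trans (Finset.sum_le_sum fun i _ => ?_)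
        rw [← mul_sub, abs_mul, abs_of_nonneg (hn u hu i)]
      refine (setLIntegral_mono' measurableSet_Ioo fun u hu =>
        ENNReal.ofReal_le_ofReal (hle u hu)).trans ?_
      rw [← ofReal_integral_eq_lintegral_ofReal hi]
      · refine ENNReal.ofReal_le_ofReal ?_
        rw [integral_finsetSum _ fun i _ => (integrableOn_jump_kernel _ _ β).const_mul _]
        refine Finset.sum_le_sum fun i hi => ?_
        rw [integral_const_mul, integral_jump_kernel hβ.1 (hp i hi)]
        refine mul_le_mul_of_nonneg_left (mul_le_mul_of_nonneg_left ?_ (jump_nonneg _ _))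
          (abs_nonneg _)
        refine div_le_div_of_nonneg_right ?_ hβ.1.le
        linarith [Real.rpow_nonneg hs.1.le (-β)]
      · refine (ae_restrict_iff' measurableSet_Ioo).2 (ae_of_all _ fun u hu => ?_)
        exact Finset.sum_nonneg fun i _ => mul_nonneg (abs_nonneg _)
          (div_nonneg (hn u hu i) (Real.rpow_nonneg (by linarith [hu.2]) _))
    have h3 : IntegrableOn (fun s => ∑ i ∈ S, |c i| * (jump (p i) s * ((s - p i) ^ (-β) / β)))
        (Ioo 0 T) := by
      refine integrable_finsetSum _ fun i _ => Integrable.const_mul ?_ _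
      have : (fun s => jump (p i) s * ((s - p i) ^ (-β) / β))
          = (Ioi (p i)).indicator fun s => (s - p i) ^ (-β) / β := by
        ext s
        simp [jump, indicator_apply]
      rw [this, integrable_indicator_iff measurableSet_Ioi, IntegrableOn,
        Measure.restrict_restrict measurableSet_Ioi]
      have hd : IntegrableOn (fun s => (s - p i) ^ (-β) / β) (Ioo (p i) T) :=
        (hk (p i) T).div_const β
      refine hd.mono_set ?_
      rintro s ⟨h1, h2⟩
      exact ⟨h1, h2.2⟩
    exact lt_of_le_of_lt (setLIntegral_mono' measurableSet_Ioo h2) h3.setLIntegral_lt_top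

end Steps

/-! ### The generalized Lebesgue–Stieltjes integral of step functions. -/

lemma besov1_lt_top {l γ K a T : ℝ} (hγ : l < γ) (hK : 0 ≤ K) {g : ℝ → ℝ}
    (hg : ∀ x ∈ Icc a T, ∀ y ∈ Icc a T, |g x - g y| ≤ K * |x - y| ^ γ) :
    besov1 l a T g < ∞ := by
  have hb : besov1 l a T g ≤ ENNReal.ofReal (K * (T - a) ^ (γ - l))
      + ENNReal.ofReal (K * ((T - a) ^ (γ - l) / (γ - l))) := by
    refine iSup₂_le fun s hs => iSup₂_le fun t ht => ?_
    have ht' : t ∈ Icc a T := ⟨hs.1.trans ht.1.le, ht.2⟩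
    have hle : (t - s) ^ (γ - l) ≤ (T - a) ^ (γ - l) :=
      Real.rpow_le_rpow (by linarith [ht.1]) (by linarith [hs.1, ht.2]) (by linarith)
    have key : ∀ u ∈ Icc a T, s < u → ∀ q, |g u - g s| / (u - s) ^ q ≤ K * (u - s) ^ (γ - q) := by
      intro u hu hsu q
      have h0 : 0 < u - s := sub_pos.2 hsu
      rw [div_le_iff₀ (Real.rpow_pos_of_pos h0 _), mul_assoc, ← Real.rpow_add h0, sub_add_cancel]
      have := hg u hu s hs
      rwa [abs_of_pos h0] at this
    refine add_le_add (ENNReal.ofReal_le_ofReal ?_) ?_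
    · exact (key t ht' ht.1 l).trans (mul_le_mul_of_nonneg_left hle hK)
    · have hi := (integrableOn_sub_rpow (a := s) (b := t) (r := γ - (1 + l))
        (by linarith)).const_mul K
      refine (setLIntegral_mono' measurableSet_Ioo fun u hu => ENNReal.ofReal_le_ofReal
        (key u ⟨hs.1.trans hu.1.le, hu.2.le.trans ht.2⟩ hu.1 (1 + l))).trans ?_
      rw [← ofReal_integral_eq_lintegral_ofReal hi]
      · refine ENNReal.ofReal_le_ofReal ?_
        rw [integral_const_mul, integral_sub_rpow ht.1.le (by linarith),
          show γ - (1 + l) + 1 = γ - l by ring]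
        exact mul_le_mul_of_nonneg_left (div_le_div_of_nonneg_right hle (by linarith)) hK
      · refine (ae_restrict_iff' measurableSet_Ioo).2 (ae_of_all _ fun u hu => ?_)
        exact mul_nonneg hK (Real.rpow_nonneg (by linarith [hu.1]) _)
  exact hb.trans_lt (ENNReal.add_lt_top.2 ⟨ENNReal.ofReal_lt_top, ENNReal.ofReal_lt_top⟩)

lemma weylRight_congr {l T s : ℝ} {g h : ℝ → ℝ} (hs : g s = h s)
    (hgh : ∀ u ∈ Ioo s T, g u = h u) : weylRight l T g s = weylRight l T h s := by
  rw [weylRight, weylRight, hs]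
  congr 3
  exact setIntegral_congr_fun measurableSet_Ioo fun u hu => by rw [hgh u hu]

/-- The generalized Lebesgue--Stieltjes integral of a step function is the corresponding
Riemann--Stieltjes sum. -/
theorem hasGLSIntegral_stepFun {ι : Type*} (S : Finset ι) (c p : ι → ℝ) {β γ K a T : ℝ}
    (hβ : β ∈ Ioo (0 : ℝ) 1) (hγ : 1 - β < γ) (hK : 0 ≤ K) (ha : 0 ≤ a) (haT : a < T)
    {g : ℝ → ℝ} (hc : ContinuousOn g (Icc 0 T))
    (hg : ∀ x ∈ Icc a T, ∀ y ∈ Icc a T, |g x - g y| ≤ K * |x - y| ^ γ)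
    (hp : ∀ i ∈ S, p i ∈ Ico a T) :
    HasGLSIntegral β T (stepFun S c p) g (∑ i ∈ S, c i * (g T - g (p i))) := by
  have hl : 1 - β ∈ Ioo (0 : ℝ) 1 := ⟨by linarith [hβ.2], by linarith [hβ.1]⟩
  have hp0 : ∀ i ∈ S, 0 ≤ p i := fun i hi => ha.trans (hp i hi).1
  refine ⟨hβ, (measurable_stepFun S c p).comp measurable_subtype_coe,
    besov2_stepFun_lt_top S c p hβ T hp0, hc, ⟨a, ⟨ha, haT⟩, fun s hs => ?_,
      besov1_lt_top hγ hK hg⟩, ?_⟩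
  · refine Finset.sum_eq_zero fun i hi => ?_
    have : ¬ p i < s := by linarith [hs.2, (hp i hi).1]
    simp [jump, this]
  -- Freezing `g` outside `[a, T]` gives a function that is Hölder on the whole line with the same
  -- constant and zero beyond `T`, as the inversion formula requires.
  let h : ℝ → ℝ := fun x => g (projIcc a T haT.le x) - g T
  have hproj : ∀ x ∈ Icc a T, h x = g x - g T := fun x hx => by
    simp only [h]; rw [projIcc_of_mem haT.le hx]
  have hh : ∀ x y, |h x - h y| ≤ K * |x - y| ^ γ := by
    intro x y
    simp only [h, sub_sub_sub_cancel_right]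
    refine (hg _ (projIcc a T haT.le x).2 _ (projIcc a T haT.le y).2).trans ?_
    refine mul_le_mul_of_nonneg_left (Real.rpow_le_rpow (abs_nonneg _) ?_ (by linarith [hl.1])) hK
    exact abs_projIcc_sub_projIcc haT.le
  have hT : ∀ x, T ≤ x → h x = 0 := fun x hx => by
    simp only [h]; rw [projIcc_of_right_le haT.le hx, sub_self]
  have hcont := continuous_of_holder (hl.1.trans hγ) hh
  have hW : ∀ s ∈ Ioo a T, weylRight (1 - β) T (fun r => g r - g T) s
      = weylRight (1 - β) T h s := fun s hs =>
    weylRight_congr (hproj s ⟨hs.1.le, hs.2.le⟩).symm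
      fun u hu => (hproj u ⟨(hs.1.trans hu.1).le, hu.2.le⟩).symm
  have hG := Real.Gamma_pos_of_pos hl.1
  -- To the left of every jump both sides vanish, so `g` and `h` are compared only on `(a, T)`.
  -- There `-β = (1 - β) - 1` is the exponent of the inversion kernel of order `1 - β`.
  have e1 : ∀ s ∈ Ioo 0 T,
      weylLeft β (stepFun S c p) s * weylRight (1 - β) T (fun r => g r - g T) s
      = ∑ i ∈ S, 1 / Real.Gamma (1 - β) * c i * ((Ioi (p i)).indicator
        (fun s => (s - p i) ^ (1 - β - 1) * weylRight (1 - β) T h s) s) := by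
    intro s hs
    rw [weylLeft_stepFun S c p hβ.1 hp0 hs.1, Finset.sum_mul]
    refine Finset.sum_congr rfl fun i hi => ?_
    by_cases hpi : p i < s
    · rw [hW s ⟨(hp i hi).1.trans_lt hpi, hs.2⟩, indicator_of_mem (mem_Ioi.2 hpi),
        show 1 - β - 1 = -β by ring]
      simp only [jump, hpi, if_true]
      ring
    · rw [indicator_of_notMem (by simpa using hpi)]
      simp [jump, hpi]
  have hset : ∀ i ∈ S, Ioo 0 T ∩ Ioi (p i) = Ioo (p i) T := by
    intro i hi
    ext s
    simp only [mem_inter_iff, mem_Ioo, mem_Ioi]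
    exact ⟨fun ⟨⟨_, h1⟩, h2⟩ => ⟨h2, h1⟩, fun ⟨h2, h1⟩ => ⟨⟨(hp0 i hi).trans_lt h2, h1⟩, h2⟩⟩
  have hint : ∀ i ∈ S, IntegrableOn ((Ioi (p i)).indicator
        (fun s => (s - p i) ^ (1 - β - 1) * weylRight (1 - β) T h s)) (Ioo 0 T) := by
    intro i hi
    rw [IntegrableOn, integrable_indicator_iff measurableSet_Ioi, IntegrableOn,
      Measure.restrict_restrict measurableSet_Ioi, inter_comm, hset i hi]
    refine Integrable.mul_bdd (c := 1 / Real.Gamma (1 - (1 - β)) * (K * (T - p i) ^ (γ - (1 - β))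
      + (1 - β) * (K * ((T - p i) ^ (γ - (1 - β)) / (γ - (1 - β)))))) (integrableOn_sub_rpow (by linarith [hl.1]))
      (measurable_weylRight hcont.measurable).aestronglyMeasurable
      ((ae_restrict_iff' measurableSet_Ioo).2 (ae_of_all _ fun s hs => ?_))
    exact abs_weylRight_le hl hK hγ hh (hT T le_rfl) hs
  rw [glsValue, setIntegral_congr_fun measurableSet_Ioo e1,
    integral_finsetSum _ fun i hi => (hint i hi).const_mul _, ← Finset.sum_neg_distrib]
  refine Finset.sum_congr rfl fun i hi => ?_
  rw [integral_const_mul, setIntegral_indicator measurableSet_Ioi, hset i hi,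
    integral_rpow_mul_weylRight hl hK hγ hh hT (hp i hi).2,
    hproj _ ⟨(hp i hi).1, (hp i hi).2.le⟩]
  field_simp
  ring

/-! ### Hölder continuity from dyadic increments. -/

section Dyadic

/-- The largest dyadic number of level `n` that is at most `t`. -/
def dyad (n : ℕ) (t : ℝ) : ℝ := (⌊2 ^ n * t⌋₊ : ℝ) / 2 ^ n

lemma dyad_le {t : ℝ} (ht : 0 ≤ t) (n : ℕ) : dyad n t ≤ t := by
  rw [dyad, div_le_iff₀ (by positivity), mul_comm t]
  exact Nat.floor_le (by positivity)

lemma lt_dyad_add (t : ℝ) (n : ℕ) : t < dyad n t + (1 / 2) ^ n := by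
  have := Nat.lt_floor_add_one (2 ^ n * t)
  rw [dyad, one_div_pow, ← add_div, lt_div_iff₀ (by positivity), mul_comm t]
  exact this

lemma dyad_mem {t : ℝ} (ht : t ∈ Icc (0 : ℝ) 1) (n : ℕ) : dyad n t ∈ Icc (0 : ℝ) 1 :=
  ⟨by unfold dyad; positivity, (dyad_le ht.1 n).trans ht.2⟩

lemma floor_le_two_pow {t : ℝ} (ht : t ∈ Icc (0 : ℝ) 1) (n : ℕ) : ⌊2 ^ n * t⌋₊ ≤ 2 ^ n := by
  refine Nat.floor_le_of_le ?_
  push_cast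
  exact mul_le_of_le_one_right (by positivity) ht.2

lemma tendsto_dyad {t : ℝ} (ht : 0 ≤ t) : Tendsto (fun n => dyad n t) atTop (𝓝 t) := by
  have h1 : Tendsto (fun n : ℕ => t - (1 / 2 : ℝ) ^ n) atTop (𝓝 t) := by
    simpa using (tendsto_pow_atTop_nhds_zero_of_lt_one (r := (1 / 2 : ℝ)) (by norm_num)
      (by norm_num)).const_sub t
  exact tendsto_of_tendsto_of_tendsto_of_le_of_le h1 tendsto_const_nhds
    (fun n => by linarith [lt_dyad_add t n]) (fun n => dyad_le ht n)

/-- A continuous function with geometrically small dyadic increments is Hölder continuous. -/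
theorem holder_of_dyadic_increments {f : ℝ → ℝ} (hc : ContinuousOn f (Icc 0 1)) {K γ : ℝ}
    (hγ : 0 < γ) (hK : 0 ≤ K)
    (h : ∀ n : ℕ, ∀ j < 2 ^ n,
      |f (((j + 1 : ℕ) : ℝ) / 2 ^ n) - f ((j : ℝ) / 2 ^ n)| ≤ K * ((1 / 2 : ℝ) ^ γ) ^ n) :
    ∃ K' ≥ 0, ∀ s ∈ Icc (0 : ℝ) 1, ∀ t ∈ Icc (0 : ℝ) 1, |f s - f t| ≤ K' * |s - t| ^ γ := by
  set ρ : ℝ := (1 / 2 : ℝ) ^ γ with hρ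
  have hρ0 : 0 < ρ := by positivity
  have hρ1 : ρ < 1 := Real.rpow_lt_one (by norm_num) (by norm_num) hγ
  -- Refining the level by one halves the floor: the dyadic approximation stays put or moves by one
  -- step of the finer mesh, according to the parity of `m`.
  have hstep : ∀ t ∈ Icc (0 : ℝ) 1, ∀ n, dist (f (dyad n t)) (f (dyad (n + 1) t)) ≤ K * ρ * ρ ^ n := by
    intro t ht n
    have h1 : ⌊2 ^ n * t⌋₊ = ⌊2 ^ (n + 1) * t⌋₊ / 2 := by
      rw [← Nat.floor_div_natCast]
      congr 1
      push_cast
      ring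
    have hm := floor_le_two_pow ht (n + 1)
    set m := ⌊2 ^ (n + 1) * t⌋₊ with hmdef
    have h2 : dyad n t = ((2 * (m / 2) : ℕ) : ℝ) / 2 ^ (n + 1) := by
      rw [dyad, h1]
      push_cast
      field_simp
      ring
    have h3 : dyad (n + 1) t = (m : ℝ) / 2 ^ (n + 1) := rfl
    rcases Nat.mod_two_eq_zero_or_one m with h0 | h0
    · have : 2 * (m / 2) = m := by omega
      rw [h2, h3, this, dist_self]
      positivity
    · have e : m = 2 * (m / 2) + 1 := by omega
      have := h (n + 1) (2 * (m / 2)) (by omega)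
      rw [← e, ← h2, ← h3] at this
      rw [dist_comm, Real.dist_eq]
      refine this.trans (le_of_eq ?_)
      ring
  have htail : ∀ t ∈ Icc (0 : ℝ) 1, ∀ n, |f (dyad n t) - f t| ≤ K * ρ * ρ ^ n / (1 - ρ) := by
    intro t ht n
    refine dist_le_of_le_geometric_of_tendsto ρ (K * ρ) hρ1 (hstep t ht) ?_ n
    have := (hc t ht).tendsto.comp (tendsto_nhdsWithin_iff.2
      ⟨tendsto_dyad ht.1, Eventually.of_forall fun n => dyad_mem ht n⟩)
    exact this
  -- Points at distance at most one mesh width have equal or neighbouring dyadic approximations.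
  have hnear : ∀ s ∈ Icc (0 : ℝ) 1, ∀ t ∈ Icc (0 : ℝ) 1, s < t → ∀ n : ℕ, t - s ≤ (1 / 2) ^ n →
      |f (dyad n s) - f (dyad n t)| ≤ K * ρ ^ n := by
    intro s hs t ht hst n hn
    have h1 : ⌊2 ^ n * s⌋₊ ≤ ⌊2 ^ n * t⌋₊ :=
      Nat.floor_le_floor (mul_le_mul_of_nonneg_left hst.le (by positivity))
    have h2 : ⌊2 ^ n * t⌋₊ ≤ ⌊2 ^ n * s⌋₊ + 1 := by
      rw [← Nat.floor_add_one (mul_nonneg (by positivity) hs.1)]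
      refine Nat.floor_le_floor ?_
      have := mul_le_mul_of_nonneg_left hn (by positivity : (0 : ℝ) ≤ 2 ^ n)
      rw [← mul_pow] at this
      norm_num at this
      linarith
    rcases h1.eq_or_lt with e | e
    · rw [dyad, dyad, e, sub_self, abs_zero]
      positivity
    · have e' : ⌊2 ^ n * t⌋₊ = ⌊2 ^ n * s⌋₊ + 1 := by omega
      have := h n ⌊2 ^ n * s⌋₊ (by have := floor_le_two_pow ht n; omega)
      rw [abs_sub_comm, dyad, dyad, e']
      exact this
  have hmain : ∀ s ∈ Icc (0 : ℝ) 1, ∀ t ∈ Icc (0 : ℝ) 1, s < t →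
      |f s - f t| ≤ (2 * (K * ρ / (1 - ρ)) + K) / ρ * |s - t| ^ γ := by
    intro s hs t ht hst
    -- The level satisfies `2^(-(n+1)) < t - s ≤ 2^(-n)`. The upper bound serves `hnear`; the lower
    -- one compares `ρ^(n+1)` with `|s - t|^γ` and costs the factor `1 / ρ`.
    obtain ⟨n, hn1, hn2⟩ := exists_nat_pow_near_of_lt_one (x := t - s) (y := (1 / 2 : ℝ))
      (by linarith) (by linarith [hs.1, ht.2]) (by norm_num) (by norm_num)
    have h1 := htail s hs n
    have h2 := htail t ht n
    have h3 := hnear s hs t ht hst n hn2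
    have h4 : |f s - f t| ≤ (2 * (K * ρ / (1 - ρ)) + K) * ρ ^ n := by
      have e : f s - f t = -(f (dyad n s) - f s) + (f (dyad n s) - f (dyad n t))
        + (f (dyad n t) - f t) := by ring
      have := (abs_add_le (-(f (dyad n s) - f s) + (f (dyad n s) - f (dyad n t)))
        (f (dyad n t) - f t)).trans (add_le_add_left (abs_add_le _ _) _)
      rw [← e, abs_neg] at this
      have e2 : (2 * (K * ρ / (1 - ρ)) + K) * ρ ^ n
        = K * ρ * ρ ^ n / (1 - ρ) + K * ρ ^ n + K * ρ * ρ ^ n / (1 - ρ) := by ring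
      rw [e2]
      linarith
    have h5 : ρ ^ (n + 1) ≤ |s - t| ^ γ := by
      rw [hρ, ← Real.rpow_natCast, ← Real.rpow_mul (by norm_num), mul_comm γ, Real.rpow_mul
        (by norm_num), Real.rpow_natCast, abs_sub_comm, abs_of_pos (sub_pos.2 hst)]
      exact Real.rpow_le_rpow (by positivity) hn1.le hγ.le
    have hA : 0 ≤ (2 * (K * ρ / (1 - ρ)) + K) / ρ := by
      have : 0 < 1 - ρ := by linarith
      positivity
    calc |f s - f t| ≤ (2 * (K * ρ / (1 - ρ)) + K) * ρ ^ n := h4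
      _ = (2 * (K * ρ / (1 - ρ)) + K) / ρ * ρ ^ (n + 1) := by
        field_simp
        ring
      _ ≤ _ := mul_le_mul_of_nonneg_left h5 hA
  refine ⟨(2 * (K * ρ / (1 - ρ)) + K) / ρ, ?_, fun s hs t ht => ?_⟩
  · have : 0 < 1 - ρ := by linarith
    positivity
  · rcases lt_trichotomy s t with hst | rfl | hst
    · exact hmain s hs t ht hst
    · simp [Real.zero_rpow hγ.ne']
    · rw [abs_sub_comm, abs_sub_comm s]
      exact hmain t ht s hs hst

end Dyadic

/-! ### First passage, and a discrete Itô identity. -/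

/-- First passage of a continuous path strictly above a level. -/
lemma exists_passage {z : ℝ → ℝ} {p q m : ℝ} (hpq : p ≤ q) (hc : ContinuousOn z (Icc p q))
    (hp : z p ≤ m) (hq : m < z q) :
    ∃ τ ∈ Ico p q, z τ = m ∧ (∀ s ∈ Icc p τ, z s ≤ m) ∧
      ∀ t, τ < t → ∃ r : ℚ, p < r ∧ (r : ℝ) < t ∧ (r : ℝ) ∈ Icc p q ∧ m < z r := by
  -- With the strict inequality the level is exceeded at times arbitrarily close after `τ`, and by
  -- continuity at rational ones. Countably many times thus suffice to detect that `τ` has passed.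
  let A : Set ℝ := {s | s ∈ Icc p q ∧ m < z s}
  have hqA : q ∈ A := ⟨⟨hpq, le_rfl⟩, hq⟩
  have hbdd : BddBelow A := ⟨p, fun s hs => hs.1.1⟩
  set τ := sInf A with hτ
  have hpτ : p ≤ τ := le_csInf ⟨q, hqA⟩ fun s hs => hs.1.1
  have hτq : τ ≤ q := csInf_le hbdd hqA
  have hτm : τ ∈ Icc p q := ⟨hpτ, hτq⟩
  have hbelow : ∀ s ∈ Ico p τ, z s ≤ m := by
    intro s hs
    by_contra hlt
    exact absurd (csInf_le hbdd (⟨⟨hs.1, hs.2.le.trans hτq⟩, not_le.1 hlt⟩ : s ∈ A))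
      (not_le.2 hs.2)
  have hle : z τ ≤ m := by
    rcases hpτ.eq_or_lt with e | hlt
    · rw [← e]; exact hp
    · have h1 : Tendsto z (𝓝[Ico p τ] τ) (𝓝 (z τ)) :=
        (hc τ hτm).mono (fun s hs => ⟨hs.1, hs.2.le.trans hτq⟩)
      have : (𝓝[Ico p τ] τ).NeBot := by
        rw [← mem_closure_iff_nhdsWithin_neBot, closure_Ico hlt.ne]
        exact ⟨hlt.le, le_rfl⟩
      exact le_of_tendsto h1 (eventually_nhdsWithin_of_forall hbelow)
  have hge : m ≤ z τ := by
    have hcl : τ ∈ closure A := csInf_mem_closure ⟨q, hqA⟩ hbdd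
    have h1 : Tendsto z (𝓝[A] τ) (𝓝 (z τ)) := (hc τ hτm).mono fun s hs => hs.1
    have : (𝓝[A] τ).NeBot := mem_closure_iff_nhdsWithin_neBot.1 hcl
    exact ge_of_tendsto h1 (eventually_nhdsWithin_of_forall fun s hs => hs.2.le)
  have heq := le_antisymm hle hge
  have hτlt : τ < q := lt_of_le_of_ne hτq fun e => by rw [e] at hle; linarith
  refine ⟨τ, ⟨hpτ, hτlt⟩, heq, fun s hs => ?_, fun t ht => ?_⟩
  · rcases hs.2.eq_or_lt with e | hlt
    · rw [e]; exact hle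
    · exact hbelow s ⟨hs.1, hlt⟩
  · obtain ⟨s, hsA, hst⟩ := exists_lt_of_csInf_lt ⟨q, hqA⟩ ht
    have hτs : τ < s := lt_of_le_of_ne (csInf_le hbdd hsA) fun e => by
      have := hsA.2; rw [← e] at this; linarith
    have h1 : Tendsto z (𝓝[Ioo τ s] s) (𝓝 (z s)) :=
      (hc s hsA.1).mono fun x hx => ⟨hpτ.trans hx.1.le, hx.2.le.trans hsA.1.2⟩
    obtain ⟨v, hv, hvs⟩ := (mem_nhdsWithin_iff_exists_mem_nhds_inter.1
      (h1.eventually (lt_mem_nhds hsA.2)))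
    obtain ⟨l, hl, hlv⟩ := exists_Ioc_subset_of_mem_nhds hv ⟨τ, hτs⟩
    obtain ⟨r, hr1, hr2⟩ := exists_rat_btwn (max_lt hl hτs)
    refine ⟨r, hpτ.trans_lt ((le_max_right _ _).trans_lt hr1), hr2.trans hst,
      ⟨hpτ.trans ((le_max_right _ _).trans_lt hr1).le, hr2.le.trans hsA.1.2⟩, ?_⟩
    exact hvs ⟨hlv ⟨(le_max_left _ _).trans_lt hr1, hr2.le⟩, (le_max_right _ _).trans_lt hr1, hr2⟩

/-- Riemann sums of `2 (x - x_0) dx` in terms of the quadratic variation. -/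
lemma sum_two_mul_increments (y : ℕ → ℝ) (n : ℕ) :
    ∑ j ∈ Finset.range n, 2 * (y j - y 0) * (y (j + 1) - y j)
      = (y n - y 0) ^ 2 - ∑ j ∈ Finset.range n, (y (j + 1) - y j) ^ 2 := by
  induction n with
  | zero => simp
  | succ n ih => rw [Finset.sum_range_succ, Finset.sum_range_succ, ih]; ring

/-! ### Transport of a Gaussian law to a given distribution. -/

section Quantile

lemma continuous_cdf (μ : Measure ℝ) [IsProbabilityMeasure μ] [NullSingletonClass μ] :
    Continuous (cdf μ) := by
  rw [continuous_iff_continuousAt]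
  intro a
  rw [(cdf μ).mono.continuousAt_iff_leftLim_eq_rightLim, StieltjesFunction.rightLim_eq]
  have h := (cdf μ).measure_singleton a
  rw [measure_cdf, measure_singleton, eq_comm, ENNReal.ofReal_eq_zero] at h
  exact le_antisymm ((cdf μ).mono.leftLim_le le_rfl) (by linarith)

/-- Every distribution function is that of a measurable function of a nondegenerate Gaussian
variable. -/
theorem exists_transport {Ω : Type*} {mΩ : MeasurableSpace Ω} {P : Measure Ω}
    {Y : Ω → ℝ} (hY : Measurable Y) {m : ℝ} {v : NNReal} (hv : v ≠ 0)
    (hlaw : P.map Y = gaussianReal m v) {F : ℝ → ℝ} (hF : IsDistributionFunction F) :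
    ∃ g : ℝ → ℝ, Measurable g ∧ ∀ x, P.real {ω | g (Y ω) ≤ x} = F x := by
  set μ := gaussianReal m v with hμ
  have : NullSingletonClass μ := nullSingletonClass_gaussianReal hv
  have hpos : ∀ s : Set ℝ, volume s ≠ 0 → 0 < μ s := fun s hs =>
    pos_iff_ne_zero.2 fun h => hs (gaussianReal_absolutelyContinuous' m hv h)
  have hΦ : ∀ y, cdf μ y = μ.real (Iic y) := cdf_eq_real μ
  have hstrict : StrictMono (cdf μ) := by
    intro a b hab
    have h1 : 0 < μ (Ioc a b) := hpos _ (by simp [hab])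
    rw [← measure_cdf μ, StieltjesFunction.measure_Ioc, ENNReal.ofReal_pos] at h1
    linarith
  have h0 : ∀ y, 0 < cdf μ y := fun y =>
    (cdf_nonneg μ (y - 1)).trans_lt (hstrict (by linarith))
  have h1 : ∀ y, cdf μ y < 1 := fun y =>
    (hstrict (by linarith : y < y + 1)).trans_le (cdf_le_one μ (y + 1))
  have hF0 : ∀ x, 0 ≤ F x := fun x => hF.mono.le_of_tendsto hF.at_bot x
  have hF1 : ∀ x, F x ≤ 1 := fun x => hF.mono.ge_of_tendsto hF.at_top x
  -- The quantile function of `F` composed with the Gaussian distribution function. As the latter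
  -- lies strictly between 0 and 1, the set is nonempty and bounded below; right continuity of `F`
  -- gives the Galois connection `hg`.
  let g : ℝ → ℝ := fun y => sInf {x | cdf μ y ≤ F x}
  have hg : ∀ y x, g y ≤ x ↔ cdf μ y ≤ F x := by
    intro y x
    have hne : {x | cdf μ y ≤ F x}.Nonempty :=
      ((hF.at_top.eventually (lt_mem_nhds (h1 y))).exists).imp fun x hx => le_of_lt hx
    obtain ⟨b, hb⟩ := (hF.at_bot.eventually (gt_mem_nhds (h0 y))).exists
    have hbdd : BddBelow {x | cdf μ y ≤ F x} := by
      refine ⟨b, fun x hx => ?_⟩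
      by_contra hlt
      exact absurd (hx.trans (hF.mono (not_le.1 hlt).le)) (not_le.2 hb)
    constructor
    · intro h
      refine le_trans ?_ (hF.mono h)
      have hcl := csInf_mem_closure hne hbdd
      have h2 : Tendsto F (𝓝[{x | cdf μ y ≤ F x}] (g y)) (𝓝 (F (g y))) :=
        (hF.right_cont (g y)).mono fun x hx => csInf_le hbdd hx
      have : (𝓝[{x | cdf μ y ≤ F x}] (g y)).NeBot := mem_closure_iff_nhdsWithin_neBot.1 hcl
      exact ge_of_tendsto h2 (eventually_nhdsWithin_of_forall fun x hx => hx)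
    · intro h
      exact csInf_le hbdd h
  have hgm : Measurable g := by
    refine measurable_of_Iic fun x => ?_
    have : g ⁻¹' Iic x = {y | cdf μ y ≤ F x} := by ext y; exact hg y x
    rw [this]
    exact measurableSet_le (cdf μ).mono.measurable measurable_const
  -- The distribution function of a continuous law is uniformly distributed under that law.
  have hlevel : ∀ p, 0 ≤ p → p ≤ 1 → μ.real {y | cdf μ y ≤ p} = p := by
    intro p hp0 hp1
    rcases hp0.eq_or_lt with rfl | hp0
    · have : {y | cdf μ y ≤ 0} = ∅ := by
        ext y; simpa using h0 y
      rw [this]; simp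
    rcases hp1.eq_or_lt with rfl | hp1
    · have : {y | cdf μ y ≤ 1} = univ := by
        ext y; simpa using (h1 y).le
      rw [this]; simp
    · obtain ⟨a, ha⟩ := ((tendsto_cdf_atBot μ).eventually (gt_mem_nhds hp0)).exists
      obtain ⟨b, hb⟩ := ((tendsto_cdf_atTop μ).eventually (lt_mem_nhds hp1)).exists
      obtain ⟨c, hc⟩ := mem_range_of_exists_le_of_exists_ge (continuous_cdf μ)
        ⟨a, ha.le⟩ ⟨b, hb.le⟩
      have : {y | cdf μ y ≤ p} = Iic c := by
        ext y
        rw [← hc]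
        exact hstrict.le_iff_le
      rw [this, ← hΦ, hc]
  refine ⟨g, hgm, fun x => ?_⟩
  have e : {ω | g (Y ω) ≤ x} = Y ⁻¹' {y | cdf μ y ≤ F x} := by
    ext ω
    exact hg (Y ω) x
  rw [e, ← map_measureReal_apply hY (measurableSet_le (cdf μ).mono.measurable measurable_const),
    hlaw, hlevel (F x) (hF0 x) (hF1 x)]

end Quantile

/-! ### Kolmogorov's criterion. -/

/-- Increments on `[a,T]` have second moments of Kolmogorov type. -/
structure IncrementBound {Ω : Type*} [MeasurableSpace Ω] (P : Measure Ω) (X : ℝ → Ω → ℝ)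
    (a T C κ : ℝ) : Prop where
  meas : ∀ t ∈ Icc a T, Measurable (X t)
  integrable : ∀ s ∈ Icc a T, ∀ t ∈ Icc a T, Integrable (fun ω => (X t ω - X s ω) ^ 2) P
  bound : ∀ s ∈ Icc a T, ∀ t ∈ Icc a T, s ≤ t → incVar P X t s ≤ C * (t - s) ^ (1 + κ)

section Kolmogorov

variable {Ω : Type*} {mΩ : MeasurableSpace Ω} {P : Measure Ω} {X : ℝ → Ω → ℝ} {a T C κ : ℝ}

lemma IncrementBound.lintegral_le (hX : IncrementBound P X a T C κ) {s t : ℝ} (hs : s ∈ Icc a T)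
    (ht : t ∈ Icc a T) (hst : s ≤ t) :
    ∫⁻ ω, ENNReal.ofReal ((X t ω - X s ω) ^ 2) ∂P ≤ ENNReal.ofReal (C * (t - s) ^ (1 + κ)) := by
  rw [← ofReal_integral_eq_lintegral_ofReal (hX.integrable s hs t ht)
    (ae_of_all _ fun ω => sq_nonneg _)]
  exact ENNReal.ofReal_le_ofReal (hX.bound s hs t ht hst)

/-- Kolmogorov's continuity criterion with exponent two. -/
theorem IncrementBound.ae_holder (hX : IncrementBound P X a T C κ) (haT : a < T)
    (hκ : 0 < κ) (hc : ∀ ω, ContinuousOn (fun t => X t ω) (Icc a T)) :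
    ∀ᵐ ω ∂P, ∃ K ≥ 0, ∀ s ∈ Icc a T, ∀ t ∈ Icc a T,
      |X s ω - X t ω| ≤ K * |s - t| ^ (κ / 4) := by
  set L := T - a with hL
  have hL0 : 0 < L := sub_pos.2 haT
  let pt : ℕ → ℕ → ℝ := fun n j => a + L * ((j : ℝ) / 2 ^ n)
  have hpt : ∀ n j, j ≤ 2 ^ n → pt n j ∈ Icc a T := by
    intro n j hj
    have h1 : (j : ℝ) / 2 ^ n ≤ 1 := by
      rw [div_le_one (by positivity)]
      exact_mod_cast hj
    have h2 : 0 ≤ (j : ℝ) / 2 ^ n := by positivity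
    refine ⟨le_add_of_nonneg_right (mul_nonneg hL0.le h2), ?_⟩
    have := mul_le_mul_of_nonneg_left h1 hL0.le
    simp only [pt]
    linarith
  -- Half of the excess exponent `κ` is spent as a weight: level `n` has `2^n` increments of second
  -- moment at most `C (L / 2^n)^(1+κ)`, so its weighted sum has mean at most a constant times
  -- `θ^(-n)`.
  set θ : ℝ := 2 ^ (κ / 2) with hθ
  have hθ0 : 0 < θ := by positivity
  have hθ1 : 1 < θ := Real.one_lt_rpow (by norm_num) (by linarith)
  let V : Ω → ℝ≥0∞ := fun ω => ∑' n : ℕ, ∑ j ∈ Finset.range (2 ^ n),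
    ENNReal.ofReal (θ ^ n) * ENNReal.ofReal ((X (pt n (j + 1)) ω - X (pt n j) ω) ^ 2)
  have hterm : ∀ n : ℕ, ∀ j ∈ Finset.range (2 ^ n), Measurable fun ω =>
      ENNReal.ofReal (θ ^ n) * ENNReal.ofReal ((X (pt n (j + 1)) ω - X (pt n j) ω) ^ 2) := by
    intro n j hj
    rw [Finset.mem_range] at hj
    have h1 := hX.meas _ (hpt n (j + 1) hj)
    have h2 := hX.meas _ (hpt n j hj.le)
    fun_prop
  have hsumm : ∀ n : ℕ, Measurable fun ω => ∑ j ∈ Finset.range (2 ^ n),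
      ENNReal.ofReal (θ ^ n) * ENNReal.ofReal ((X (pt n (j + 1)) ω - X (pt n j) ω) ^ 2) :=
    fun n => Finset.measurable_fun_sum _ (hterm n)
  have hVm : Measurable V := Measurable.tsum hsumm
  have hV : ∫⁻ ω, V ω ∂P ≠ ∞ := by
    have h1 : ∀ n : ℕ, ∫⁻ ω, ∑ j ∈ Finset.range (2 ^ n),
        ENNReal.ofReal (θ ^ n) * ENNReal.ofReal ((X (pt n (j + 1)) ω - X (pt n j) ω) ^ 2) ∂P
        ≤ ENNReal.ofReal (C * L ^ (1 + κ) * θ⁻¹ ^ n) := by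
      intro n
      rw [lintegral_finsetSum' _ fun j hj => (hterm n j hj).aemeasurable]
      have h2 : ∀ j ∈ Finset.range (2 ^ n), ∫⁻ ω, ENNReal.ofReal (θ ^ n) *
          ENNReal.ofReal ((X (pt n (j + 1)) ω - X (pt n j) ω) ^ 2) ∂P
          ≤ ENNReal.ofReal (θ ^ n * (C * (L / 2 ^ n) ^ (1 + κ))) := by
        intro j hj
        rw [Finset.mem_range] at hj
        have e : pt n (j + 1) - pt n j = L / 2 ^ n := by
          simp only [pt]
          push_cast
          ring
        have := hX.lintegral_le (hpt n j hj.le) (hpt n (j + 1) hj)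
          (by have : 0 < L / 2 ^ n := by positivity
              linarith)
        rw [e] at this
        rw [lintegral_const_mul' _ _ ENNReal.ofReal_ne_top, ENNReal.ofReal_mul (by positivity)]
        gcongr
      refine (Finset.sum_le_sum h2).trans (le_of_eq ?_)
      rw [Finset.sum_const, Finset.card_range, ← ENNReal.ofReal_nsmul, nsmul_eq_mul]
      congr 1
      have e1 : ((2 : ℝ) ^ n) ^ (1 + κ) = 2 ^ n * (θ ^ n * θ ^ n) := by
        rw [Real.rpow_add (by positivity), Real.rpow_one, ← mul_pow, hθ,
          ← Real.rpow_add (by norm_num), add_halves, ← Real.rpow_natCast, ← Real.rpow_natCast,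
          ← Real.rpow_mul (by norm_num), ← Real.rpow_mul (by norm_num), mul_comm (n : ℝ)]
      rw [Real.div_rpow hL0.le (by positivity), e1, inv_pow]
      push_cast
      field_simp
    simp only [V]
    rw [lintegral_tsum fun n => (hsumm n).aemeasurable]
    refine ne_top_of_le_ne_top ?_ (ENNReal.tsum_le_tsum h1)
    have hs : Summable fun n : ℕ => C * L ^ (1 + κ) * θ⁻¹ ^ n :=
      (summable_geometric_of_lt_one (by positivity) (inv_lt_one_of_one_lt₀ hθ1)).mul_left _
    exact hs.tsum_ofReal_ne_top
  filter_upwards [ae_lt_top hVm hV] with ω hω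
  set v := (V ω).toReal with hv
  -- Chosen so that `θ ρ^2 = 1`: the weighted sum of squares bounds every single increment at level
  -- `n` by `√v ρ^n`.
  set ρ : ℝ := (1 / 2) ^ (κ / 4) with hρ
  have hρθ : ∀ n : ℕ, θ ^ n * (ρ ^ n) ^ 2 = 1 := by
    intro n
    rw [← pow_mul, mul_comm n 2, pow_mul, ← mul_pow]
    have : θ * ρ ^ 2 = 1 := by
      rw [hρ, hθ, one_div, Real.inv_rpow (by norm_num), inv_pow, ← Real.rpow_natCast,
        ← Real.rpow_mul (by norm_num)]
      rw [show κ / 4 * ((2 : ℕ) : ℝ) = κ / 2 by push_cast; ring]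
      exact mul_inv_cancel₀ hθ0.ne'
    rw [this, one_pow]
  have hincr : ∀ n : ℕ, ∀ j < 2 ^ n,
      |X (pt n (j + 1)) ω - X (pt n j) ω| ≤ √v * ρ ^ n := by
    intro n j hj
    have h1 : ENNReal.ofReal (θ ^ n * (X (pt n (j + 1)) ω - X (pt n j) ω) ^ 2) ≤ V ω := by
      rw [ENNReal.ofReal_mul (by positivity)]
      refine le_trans ?_ (ENNReal.le_tsum n)
      exact Finset.single_le_sum (f := fun j => ENNReal.ofReal (θ ^ n) *
        ENNReal.ofReal ((X (pt n (j + 1)) ω - X (pt n j) ω) ^ 2)) (fun _ _ => zero_le)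
        (Finset.mem_range.2 hj)
    have h2 : θ ^ n * (X (pt n (j + 1)) ω - X (pt n j) ω) ^ 2 ≤ v :=
      (ENNReal.ofReal_le_iff_le_toReal hω.ne).1 h1
    have h3 : (X (pt n (j + 1)) ω - X (pt n j) ω) ^ 2 ≤ v * (ρ ^ n) ^ 2 := by
      have := mul_le_mul_of_nonneg_right h2 (sq_nonneg (ρ ^ n))
      have e := hρθ n
      calc _ = θ ^ n * (ρ ^ n) ^ 2 * (X (pt n (j + 1)) ω - X (pt n j) ω) ^ 2 := by rw [e, one_mul]
        _ = θ ^ n * (X (pt n (j + 1)) ω - X (pt n j) ω) ^ 2 * (ρ ^ n) ^ 2 := by ring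
        _ ≤ _ := this
    have h4 := Real.abs_le_sqrt h3
    rwa [Real.sqrt_mul ENNReal.toReal_nonneg, Real.sqrt_sq (by positivity)] at h4
  have hcont : ContinuousOn (fun r => X (a + L * r) ω) (Icc 0 1) := by
    refine (hc ω).comp (by fun_prop) fun r hr => ?_
    refine ⟨le_add_of_nonneg_right (mul_nonneg hL0.le hr.1), ?_⟩
    have := mul_le_mul_of_nonneg_left hr.2 hL0.le
    linarith
  obtain ⟨K, hK0, hK⟩ := holder_of_dyadic_increments hcont (γ := κ / 4) (by linarith)
    (Real.sqrt_nonneg v) hincr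
  refine ⟨K / L ^ (κ / 4), by positivity, fun s hs t ht => ?_⟩
  have hmem : ∀ s ∈ Icc a T, (s - a) / L ∈ Icc (0 : ℝ) 1 := fun s hs =>
    ⟨div_nonneg (by linarith [hs.1]) hL0.le, (div_le_one hL0).2 (by linarith [hs.2])⟩
  have hpt' : ∀ s, a + L * ((s - a) / L) = s := fun s => by field_simp; ring
  have h1 := hK _ (hmem s hs) _ (hmem t ht)
  simp only [hpt'] at h1
  rw [← sub_div, sub_sub_sub_cancel_right, abs_div, abs_of_pos hL0,
    Real.div_rpow (abs_nonneg _) hL0.le] at h1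
  rw [div_mul_eq_mul_div, ← mul_div_assoc']
  exact h1

/-! ### Riemann sums and vanishing quadratic variation. -/

/-- The equidistant grid of `n` steps on `[s,t]`. -/
def grid (s t : ℝ) (n j : ℕ) : ℝ := s + j * ((t - s) / n)

lemma grid_mono {s t : ℝ} (hst : s ≤ t) (n : ℕ) {i j : ℕ} (hij : i ≤ j) :
    grid s t n i ≤ grid s t n j := by
  have h1 : 0 ≤ (t - s) / n := div_nonneg (sub_nonneg.2 hst) (Nat.cast_nonneg _)
  have h2 : (i : ℝ) ≤ j := by exact_mod_cast hij
  have := mul_le_mul_of_nonneg_right h2 h1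
  unfold grid
  linarith

lemma grid_zero (s t : ℝ) (n : ℕ) : grid s t n 0 = s := by simp [grid]

lemma grid_last (s t : ℝ) {n : ℕ} (hn : 0 < n) : grid s t n n = t := by
  have : (n : ℝ) ≠ 0 := by exact_mod_cast hn.ne'
  unfold grid
  field_simp
  ring

lemma grid_mem {s t : ℝ} (hst : s ≤ t) {n j : ℕ} (hn : 0 < n) (hj : j ≤ n) :
    grid s t n j ∈ Icc s t := by
  have h1 := grid_mono hst n (Nat.zero_le j)
  have h2 := grid_mono hst n hj
  rw [grid_zero] at h1
  rw [grid_last s t hn] at h2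
  exact ⟨h1, h2⟩

/-- On any interval a multiple of a Riemann sum of `2 (X - X_s) dX` exceeds one with probability
close to one. -/
theorem IncrementBound.exists_riemannSum [IsProbabilityMeasure P]
    (hX : IncrementBound P X a T C κ) (hκ : 0 < κ) {s t : ℝ} (hs : s ∈ Icc a T)
    (ht : t ∈ Icc a T) (hst : s < t) (h0 : P {ω | X t ω = X s ω} = 0) {η : ℝ≥0∞} (hη : 0 < η) :
    ∃ n : ℕ, 0 < n ∧ ∃ c : ℝ, P {ω | (∑ j ∈ Finset.range n, c * (2 * (X (grid s t n j) ω - X s ω)) *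
        (X (grid s t n (j + 1)) ω - X (grid s t n j) ω)) < 1} ≤ η := by
  have hη2 : 0 < η / 2 := ENNReal.half_pos hη.ne'
  have hms := hX.meas s hs
  have hmt := hX.meas t ht
  -- Half of the allowed probability goes to a small total increment, the other half to a large
  -- quadratic variation. If neither occurs, the Riemann sum exceeds `2ε - ε = ε`, hence the factor
  -- `1 / ε`.
  obtain ⟨ε, hε, hε1⟩ : ∃ ε : ℝ, 0 < ε ∧ P {ω | (X t ω - X s ω) ^ 2 < 2 * ε} ≤ η / 2 := by
    have hanti : Antitone fun m : ℕ => {ω | (X t ω - X s ω) ^ 2 < 2 * (1 / ((m : ℝ) + 1))} := by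
      intro m k hmk ω hω
      have hω' : (X t ω - X s ω) ^ 2 < 2 * (1 / ((k : ℝ) + 1)) := hω
      change (X t ω - X s ω) ^ 2 < 2 * (1 / ((m : ℝ) + 1))
      have := Nat.one_div_le_one_div (α := ℝ) hmk
      linarith
    have hlim := tendsto_measure_iInter_atTop (μ := P) (fun m : ℕ => (measurableSet_lt
      (by fun_prop : Measurable fun ω => (X t ω - X s ω) ^ 2)
      (measurable_const (a := 2 * (1 / ((m : ℝ) + 1))))).nullMeasurableSet) hanti
      ⟨0, measure_ne_top _ _⟩
    have hset : (⋂ m : ℕ, {ω | (X t ω - X s ω) ^ 2 < 2 * (1 / ((m : ℝ) + 1))})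
        ⊆ {ω | X t ω = X s ω} := by
      intro ω hω
      rw [mem_iInter] at hω
      have h1 : (X t ω - X s ω) ^ 2 ≤ 0 := by
        have h2 := (tendsto_one_div_add_atTop_nhds_zero_nat (𝕜 := ℝ)).const_mul 2
        rw [mul_zero] at h2
        exact ge_of_tendsto' h2 fun m => (hω m).le
      exact sub_eq_zero.1 (pow_eq_zero_iff (two_ne_zero)|>.1 (le_antisymm h1 (sq_nonneg _)))
    rw [measure_mono_null hset h0] at hlim
    obtain ⟨m, hm⟩ := (hlim.eventually (gt_mem_nhds hη2)).exists
    exact ⟨1 / ((m : ℝ) + 1), Nat.one_div_pos_of_nat, hm.le⟩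
  -- This is Markov's bound: `n` squared increments, each of mean at most `C ((t - s) / n)^(1+κ)`,
  -- divided by `ε`.
  have hlim : Tendsto (fun n : ℕ => ENNReal.ofReal (C * (t - s) / ε * ((t - s) / n) ^ κ)) atTop
      (𝓝 0) := by
    have h1 : Tendsto (fun n : ℕ => ((t - s) / n) ^ κ) atTop (𝓝 0) := by
      have := (tendsto_const_div_atTop_nhds_zero_nat (t - s)).rpow_const (p := κ) (Or.inr hκ.le)
      rwa [Real.zero_rpow hκ.ne'] at this
    have h2 := ENNReal.tendsto_ofReal (h1.const_mul (C * (t - s) / ε))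
    rwa [mul_zero, ENNReal.ofReal_zero] at h2
  obtain ⟨n, hn1, hn0⟩ := ((hlim.eventually (gt_mem_nhds hη2)).and (eventually_gt_atTop 0)).exists
  have hn0' : (n : ℝ) ≠ 0 := by exact_mod_cast hn0.ne'
  refine ⟨n, hn0, 1 / ε, ?_⟩
  have hg : ∀ j ≤ n, grid s t n j ∈ Icc a T := fun j hj =>
    ⟨hs.1.trans (grid_mem hst.le hn0 hj).1, (grid_mem hst.le hn0 hj).2.trans ht.2⟩
  have hqm : ∀ j ∈ Finset.range n,
      Measurable fun ω => (X (grid s t n (j + 1)) ω - X (grid s t n j) ω) ^ 2 := by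
    intro j hj
    rw [Finset.mem_range] at hj
    have h1 := hX.meas _ (hg (j + 1) hj)
    have h2 := hX.meas _ (hg j hj.le)
    fun_prop
  have hqv : P {ω | ε ≤ ∑ j ∈ Finset.range n, (X (grid s t n (j + 1)) ω - X (grid s t n j) ω) ^ 2}
      ≤ η / 2 := by
    have h1 := meas_ge_le_lintegral_div (μ := P) (f := fun ω => ENNReal.ofReal
      (∑ j ∈ Finset.range n, (X (grid s t n (j + 1)) ω - X (grid s t n j) ω) ^ 2))
      (Finset.measurable_fun_sum _ hqm).ennreal_ofReal.aemeasurable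
      (ENNReal.ofReal_pos.2 hε).ne' ENNReal.ofReal_ne_top
    have h2 : ∫⁻ ω, ENNReal.ofReal
        (∑ j ∈ Finset.range n, (X (grid s t n (j + 1)) ω - X (grid s t n j) ω) ^ 2) ∂P
        ≤ ENNReal.ofReal (n * (C * ((t - s) / n) ^ (1 + κ))) := by
      simp_rw [ENNReal.ofReal_sum_of_nonneg fun j _ => sq_nonneg
        (X (grid s t n (j + 1)) _ - X (grid s t n j) _)]
      rw [lintegral_finsetSum' _ fun j hj => (hqm j hj).ennreal_ofReal.aemeasurable,
        ← nsmul_eq_mul, ENNReal.ofReal_nsmul]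
      refine (Finset.sum_le_card_nsmul _ _ _ fun j hj => ?_).trans_eq
        (by rw [Finset.card_range])
      rw [Finset.mem_range] at hj
      have := hX.lintegral_le (hg j hj.le) (hg (j + 1) hj) (grid_mono hst.le n (Nat.le_succ j))
      rwa [show grid s t n (j + 1) - grid s t n j = (t - s) / n by
        unfold grid; push_cast; ring] at this
    refine le_trans ?_ (h1.trans (le_trans (ENNReal.div_le_div_right h2 _) (le_trans ?_ hn1.le)))
    · refine measure_mono fun ω hω => ?_
      exact ENNReal.ofReal_le_ofReal hω
    · rw [← ENNReal.ofReal_div_of_pos hε]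
      refine ENNReal.ofReal_le_ofReal (le_of_eq ?_)
      have : 0 < (t - s) / n := div_pos (sub_pos.2 hst) (by positivity)
      rw [Real.rpow_add this, Real.rpow_one]
      field_simp
  have hsub : {ω | (∑ j ∈ Finset.range n, 1 / ε * (2 * (X (grid s t n j) ω - X s ω)) *
        (X (grid s t n (j + 1)) ω - X (grid s t n j) ω)) < 1}
      ⊆ {ω | (X t ω - X s ω) ^ 2 < 2 * ε} ∪ {ω | ε ≤ ∑ j ∈ Finset.range n,
        (X (grid s t n (j + 1)) ω - X (grid s t n j) ω) ^ 2} := by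
    intro ω hω
    by_contra hnot
    simp only [mem_union, mem_ofPred_eq, not_or, not_lt, not_le] at hnot hω
    have h1 := sum_two_mul_increments (fun j => X (grid s t n j) ω) n
    simp only [grid_zero, grid_last s t hn0] at h1
    simp_rw [mul_assoc (1 / ε)] at hω
    rw [← Finset.mul_sum, h1, one_div, inv_mul_lt_iff₀ hε] at hω
    linarith [hnot.1, hnot.2]
  refine (measure_mono hsub).trans ((measure_union_le _ _).trans ?_)
  exact (add_le_add hε1 hqv).trans (ENNReal.add_halves η).le

end Kolmogorov

/-! ### The adapted trading strategy. -/

section Strategy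

variable {Ω : Type*} (X : ℝ → Ω → ℝ) (u : ℕ → ℝ) (n : ℕ → ℕ) (c : ℕ → ℝ)

/-- The `j`-th trading time in the `k`-th block `[u k, u (k+1)]`. -/
def node (k j : ℕ) : ℝ := grid (u k) (u (k + 1)) (n k) j

/-- The position held in the interval that starts at `node u n k j`. -/
def position (k j : ℕ) (ω : Ω) : ℝ := c k * (2 * (X (node u n k j) ω - X (u k) ω))

/-- The accumulated gain at time `t` in the first `N` blocks. -/
def gain (N : ℕ) (t : ℝ) (ω : Ω) : ℝ :=
  ∑ k ∈ Finset.range N, ∑ j ∈ Finset.range (n k), position X u n c k j ω *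
    (X (min t (node u n k (j + 1))) ω - X (min t (node u n k j)) ω)

/-- The position held at time `t`, in the first `N` blocks. -/
def holding (N : ℕ) (t : ℝ) (ω : Ω) : ℝ :=
  ∑ k ∈ Finset.range N, ∑ j ∈ Finset.range (n k), position X u n c k j ω *
    (jump (node u n k j) t - jump (node u n k (j + 1)) t)

variable {X u n c}

lemma node_mono (hu : Monotone u) (k : ℕ) {i j : ℕ} (hij : i ≤ j) :
    node u n k i ≤ node u n k j := grid_mono (hu (Nat.le_succ k)) _ hij

lemma le_node (hu : Monotone u) (k j : ℕ) : u k ≤ node u n k j := by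
  have := grid_mono (hu (Nat.le_succ k)) (n k) (Nat.zero_le j)
  rwa [grid_zero] at this

/-- Blocks that start at or after `t` contribute only increments stopped at `t`, which are zero. The
infinite sum over blocks can therefore be cut at any index that reaches past `t`. -/
lemma gain_eq_of_le (hu : Monotone u) {N M : ℕ} {t : ℝ} (hN : t ≤ u N) (hNM : N ≤ M) (ω : Ω) :
    gain X u n c M t ω = gain X u n c N t ω := by
  refine (Finset.sum_subset (Finset.range_mono hNM) fun k _ hk => ?_).symm
  rw [Finset.mem_range, not_lt] at hk
  refine Finset.sum_eq_zero fun j _ => ?_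
  have h : ∀ j, t ≤ node u n k j := fun j => (hN.trans (hu hk)).trans (le_node hu k j)
  rw [min_eq_left (h _), min_eq_left (h _), sub_self, mul_zero]

lemma holding_eq_of_le (hu : Monotone u) {N M : ℕ} {t : ℝ} (hN : t ≤ u N) (hNM : N ≤ M)
    (ω : Ω) : holding X u n c M t ω = holding X u n c N t ω := by
  refine (Finset.sum_subset (Finset.range_mono hNM) fun k _ hk => ?_).symm
  rw [Finset.mem_range, not_lt] at hk
  refine Finset.sum_eq_zero fun j _ => ?_
  have h : ∀ j, ¬ node u n k j < t := fun j =>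
    not_lt.2 ((hN.trans (hu hk)).trans (le_node hu k j))
  simp [jump, h]

lemma gain_congr (hu : Monotone u) {N M : ℕ} {t : ℝ} (hN : t ≤ u N) (hM : t ≤ u M) (ω : Ω) :
    gain X u n c M t ω = gain X u n c N t ω := by
  rcases le_total N M with h | h
  · exact gain_eq_of_le hu hN h ω
  · exact (gain_eq_of_le hu hM h ω).symm

lemma holding_congr (hu : Monotone u) {N M : ℕ} {t : ℝ} (hN : t ≤ u N) (hM : t ≤ u M) (ω : Ω) :
    holding X u n c M t ω = holding X u n c N t ω := by
  rcases le_total N M with h | h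
  · exact holding_eq_of_le hu hN h ω
  · exact (holding_eq_of_le hu hM h ω).symm

lemma gain_start (hu : Monotone u) (N : ℕ) (ω : Ω) : gain X u n c N (u 0) ω = 0 :=
  (gain_eq_of_le hu le_rfl (Nat.zero_le N) ω).trans (by simp [gain])

lemma node_le (hu : Monotone u) {k j : ℕ} (hj : j ≤ n k) (hn : 0 < n k) :
    node u n k j ≤ u (k + 1) := (grid_mem (hu (Nat.le_succ k)) hn hj).2

lemma gain_end (hu : Monotone u) (hn : ∀ k, 0 < n k) (N : ℕ) (ω : Ω) :
    gain X u n c N (u N) ω = ∑ k ∈ Finset.range N, ∑ j ∈ Finset.range (n k),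
      position X u n c k j ω * (X (node u n k (j + 1)) ω - X (node u n k j) ω) := by
  refine Finset.sum_congr rfl fun k hk => Finset.sum_congr rfl fun j hj => ?_
  rw [Finset.mem_range] at hk hj
  have h : ∀ j ≤ n k, node u n k j ≤ u N := fun j hj =>
    (node_le hu hj (hn k)).trans (hu hk)
  rw [min_eq_right (h _ hj), min_eq_right (h _ hj.le)]

lemma continuousOn_gain {T : ℝ} (hu : Monotone u) (hu0 : 0 ≤ u 0) (N : ℕ) (ω : Ω)
    (hX : ContinuousOn (fun t => X t ω) (Icc 0 T)) :
    ContinuousOn (fun t => gain X u n c N t ω) (Icc 0 T) := by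
  refine continuousOn_finsetSum _ fun k _ => continuousOn_finsetSum _ fun j _ =>
    continuousOn_const.mul ?_
  have h : ∀ j, ContinuousOn (fun t => X (min t (node u n k j)) ω) (Icc 0 T) := fun j =>
    hX.comp (by fun_prop) fun t ht => ⟨le_min ht.1 ((hu0.trans (hu (Nat.zero_le k))).trans
      (le_node hu k j)), (min_le_left _ _).trans ht.2⟩
  exact (h _).sub (h _)

lemma measurable_position {m : MeasurableSpace Ω} (hu : Monotone u) (hu0 : 0 ≤ u 0) {t : ℝ}
    (hX : ∀ s ∈ Icc 0 t, Measurable[m] (X s)) {k j : ℕ} (h : node u n k j ≤ t) :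
    Measurable[m] (position X u n c k j) := by
  have hk := hu0.trans (hu (Nat.zero_le k))
  have h1 := hX _ ⟨hk.trans (le_node hu k j), h⟩
  have h2 := hX (u k) ⟨hk, (le_node hu k j).trans h⟩
  unfold position
  fun_prop

/-- Positions taken after `t` need not be known at `t`, but they multiply a zero increment. -/
lemma measurable_gain {m : MeasurableSpace Ω} (hu : Monotone u) (hu0 : 0 ≤ u 0) {t : ℝ}
    (ht : 0 ≤ t) (hX : ∀ s ∈ Icc 0 t, Measurable[m] (X s)) (N : ℕ) :
    Measurable[m] (gain X u n c N t) := by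
  refine Finset.measurable_fun_sum _ fun k _ => Finset.measurable_fun_sum _ fun j _ => ?_
  by_cases h : node u n k j ≤ t
  · have h1 := measurable_position (c := c) hu hu0 hX h
    have h2 : ∀ j, Measurable[m] (X (min t (node u n k j))) := fun j =>
      hX _ ⟨le_min ht ((hu0.trans (hu (Nat.zero_le k))).trans (le_node hu k j)), min_le_left _ _⟩
    exact h1.mul ((h2 _).sub (h2 _))
  · have h' := (not_le.1 h).le
    simp only [min_eq_left h', min_eq_left (h'.trans (node_mono hu k (Nat.le_succ j))), sub_self,
      mul_zero]
    exact measurable_const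

lemma measurable_holding {m : MeasurableSpace Ω} (hu : Monotone u) (hu0 : 0 ≤ u 0) {t : ℝ}
    (hX : ∀ s ∈ Icc 0 t, Measurable[m] (X s)) (N : ℕ) :
    Measurable[m] (holding X u n c N t) := by
  refine Finset.measurable_fun_sum _ fun k _ => Finset.measurable_fun_sum _ fun j _ => ?_
  by_cases h : node u n k j ≤ t
  · exact (measurable_position (c := c) hu hu0 hX h).mul_const _
  · have h1 : ¬ node u n k j < t := fun h2 => h h2.le
    have h2 : ¬ node u n k (j + 1) < t := fun h2 =>
      h1 ((node_mono hu k (Nat.le_succ j)).trans_lt h2)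
    simp only [jump, h1, h2, if_false, sub_self, mul_zero]
    exact measurable_const

/-- The sign of a real number, with value `1` at `0`. -/
def signOne (x : ℝ) : ℝ := if 0 ≤ x then 1 else -1

lemma measurable_signOne : Measurable signOne :=
  Measurable.ite measurableSet_Ici measurable_const measurable_const

lemma signOne_mul_abs (x : ℝ) : signOne x * |x| = x := by
  unfold signOne
  split_ifs with h
  · rw [abs_of_nonneg h, one_mul]
  · rw [abs_of_neg (not_le.1 h)]; ring

variable (X u n c)

open Classical in
/-- Trade in the blocks until the gain first exceeds `|G|`. The number `N t` of blocks taken into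
account at time `t` has to satisfy `t ≤ u (N t)`. -/
def strategy (N : ℝ → ℕ) (G : Ω → ℝ) (t : ℝ) (ω : Ω) : ℝ :=
  if u 0 < t ∧ ∀ q : ℚ, u 0 < q → (q : ℝ) < t → gain X u n c (N q) q ω ≤ |G ω|
  then signOne (G ω) * holding X u n c (N t) t ω else 0

variable {X u n c}

/-- The stopping rule is a countable intersection of events about gains at rational times before
`t`. Knowledge of `G` is needed only from `u 0` on, since no position is held earlier. -/
lemma measurable_strategy {m : MeasurableSpace Ω} (hu : Monotone u) (hu0 : 0 ≤ u 0) {t : ℝ}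
    (hX : ∀ s ∈ Icc 0 t, Measurable[m] (X s)) (N : ℝ → ℕ) {G : Ω → ℝ}
    (hG : u 0 ≤ t → Measurable[m] G) : Measurable[m] (strategy X u n c N G t) := by
  by_cases h : u 0 < t
  · have hGm := hG h.le
    have hset : {ω | u 0 < t ∧ ∀ q : ℚ, u 0 < q → (q : ℝ) < t → gain X u n c (N q) q ω ≤ |G ω|}
        = ⋂ q : ℚ, {ω | u 0 < q → (q : ℝ) < t → gain X u n c (N q) q ω ≤ |G ω|} := by
      ext ω
      simp [h]
    refine Measurable.ite ?_ ((measurable_signOne.comp hGm).mul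
      (measurable_holding hu hu0 hX _)) measurable_const
    rw [hset]
    refine MeasurableSet.iInter fun q => ?_
    by_cases h1 : u 0 < q
    · by_cases h2 : (q : ℝ) < t
      · simp only [h1, h2, forall_const]
        exact measurableSet_le (measurable_gain hu hu0 (hu0.trans h1.le)
          (fun s hs => hX s ⟨hs.1, hs.2.trans h2.le⟩) _) (measurable_abs.comp hGm)
      · simp [h2]
    · simp [h1]
  · have : strategy X u n c N G t = fun _ => 0 := by
      ext ω
      simp [strategy, h]
    rw [this]
    exact measurable_const

lemma jump_min_eq_of_le {r τ t : ℝ} (h : t ≤ τ) : jump (min τ r) t = jump r t := by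
  simp [jump, not_lt.2 h]

lemma jump_min_eq_one {r τ t : ℝ} (h : τ < t) : jump (min τ r) t = 1 := by
  simp [jump, h]

/-- On a path on which the gain eventually exceeds `|G|`, the integral of the strategy is `G`. -/
theorem hasGLSIntegral_strategy {β γ K a T : ℝ} (hβ : β ∈ Ioo (0 : ℝ) 1) (hγ : 1 - β < γ)
    (hK : 0 ≤ K) (ha : 0 ≤ a) (hu : Monotone u) (hau : a ≤ u 0) (huT : ∀ k, u k < T)
    {N : ℝ → ℕ} (hN : ∀ t < T, t ≤ u (N t)) {G : Ω → ℝ} {ω : Ω}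
    (hc : ContinuousOn (fun t => X t ω) (Icc 0 T))
    (hX : ∀ x ∈ Icc a T, ∀ y ∈ Icc a T, |X x ω - X y ω| ≤ K * |x - y| ^ γ)
    {M : ℕ} (hM : |G ω| < gain X u n c M (u M) ω) :
    HasGLSIntegral β T (fun s => strategy X u n c N G s ω) (fun s => X s ω) (G ω) := by
  have hu0 : 0 ≤ u 0 := ha.trans hau
  have hzc := (continuousOn_gain (n := n) (c := c) hu hu0 M ω hc).mono
    (Icc_subset_Icc hu0 (huT M).le : Icc (u 0) (u M) ⊆ Icc 0 T)
  obtain ⟨τ, hτ, hzτ, hbelow, hafter⟩ := exists_passage (hu (Nat.zero_le M)) hzc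
    (by rw [gain_start hu]; exact abs_nonneg (G ω)) hM
  have hτT : τ < T := hτ.2.trans (huT M)
  have hgain : ∀ t ≤ u M, gain X u n c (N t) t ω = gain X u n c M t ω := fun t ht =>
    gain_congr hu ht (hN t (ht.trans_lt (huT M))) ω
  let S : Finset (Σ _ : ℕ, ℕ) := (Finset.range M).sigma fun k => Finset.range (n k)
  let A : (Σ _ : ℕ, ℕ) → ℝ := fun i => signOne (G ω) * position X u n c i.1 i.2 ω
  -- Stopping moves every later node to `τ`; a trade that would start after `τ` opens and closes
  -- there and disappears.
  let p : (Σ _ : ℕ, ℕ) → ℝ := fun i => min τ (node u n i.1 i.2)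
  let p' : (Σ _ : ℕ, ℕ) → ℝ := fun i => min τ (node u n i.1 (i.2 + 1))
  have hmem : ∀ k j, min τ (node u n k j) ∈ Ico a T := fun k j =>
    ⟨le_min (hau.trans hτ.1) (hau.trans ((hu (Nat.zero_le k)).trans (le_node hu k j))),
      (min_le_left _ _).trans_lt hτT⟩
  -- Each trade is a pair of jumps with opposite coefficients: the left summand opens it, the right
  -- one closes it.
  have hmain := hasGLSIntegral_stepFun (S.disjSum S) (Sum.elim A fun i => -A i) (Sum.elim p p')
    hβ hγ hK ha (hau.trans_lt (huT 0)) hc hX (by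
      rintro (i | i) _
      · exact hmem _ _
      · exact hmem _ _)
  have hfun : (fun s => strategy X u n c N G s ω)
      = stepFun (S.disjSum S) (Sum.elim A fun i => -A i) (Sum.elim p p') := by
    ext t
    have e : stepFun (S.disjSum S) (Sum.elim A fun i => -A i) (Sum.elim p p') t
        = ∑ i ∈ S, A i * (jump (p i) t - jump (p' i) t) := by
      rw [stepFun, Finset.sum_disjSum, ← Finset.sum_add_distrib]
      refine Finset.sum_congr rfl fun i _ => ?_
      simp only [Sum.elim_inl, Sum.elim_inr]
      ring
    rw [e]
    -- After `τ` a rational time with gain above `|G|` has been seen, so the strategy is zero. Up to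
    -- and including `τ` no such time exists, and stopping does not affect the jumps.
    rcases lt_or_ge τ t with hτt | htτ
    · rw [Finset.sum_eq_zero fun i _ => by
        simp only [p, p', jump_min_eq_one hτt, sub_self, mul_zero]]
      obtain ⟨r, hr1, hr2, hr3, hr4⟩ := hafter t hτt
      refine if_neg fun h => ?_
      have := h.2 r hr1 hr2
      rw [hgain r hr3.2] at this
      linarith
    · simp only [p, p', jump_min_eq_of_le htτ, A, mul_assoc]
      rw [← Finset.mul_sum, Finset.sum_sigma]
      have hh : holding X u n c (N t) t ω = holding X u n c M t ω :=
        holding_congr hu (htτ.trans hτ.2.le) (hN t (htτ.trans_lt hτT)) ω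
      change _ = signOne (G ω) * holding X u n c M t ω
      by_cases h0 : u 0 < t
      · rw [strategy, if_pos, hh]
        refine ⟨h0, fun q hq1 hq2 => ?_⟩
        rw [hgain q ((hq2.le.trans htτ).trans hτ.2.le)]
        exact hbelow q ⟨hq1.le, hq2.le.trans htτ⟩
      · rw [strategy, if_neg (fun h => h0 h.1), holding_eq_of_le hu (not_lt.1 h0) (Nat.zero_le M)]
        simp [holding]
  have hval : ∑ i ∈ S.disjSum S, Sum.elim A (fun i => -A i) i *
      (X T ω - X (Sum.elim p p' i) ω) = G ω := by
    rw [Finset.sum_disjSum, ← Finset.sum_add_distrib, ← signOne_mul_abs (G ω), ← hzτ, gain,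
      Finset.sum_sigma', Finset.mul_sum]
    refine Finset.sum_congr rfl fun i _ => ?_
    simp only [Sum.elim_inl, Sum.elim_inr, A, p, p']
    ring
  rw [hfun, ← hval]
  exact hmain

end Strategy

lemma exists_lt_sum_range {b : ℕ → ℝ} (hb : ∀ᶠ k in atTop, 1 ≤ b k) (R : ℝ) :
    ∃ N, R < ∑ k ∈ Finset.range N, b k := by
  obtain ⟨N, hN⟩ := eventually_atTop.1 hb
  obtain ⟨m, hm⟩ := exists_nat_gt (R - ∑ k ∈ Finset.range N, b k)
  refine ⟨N + m, ?_⟩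
  rw [Finset.sum_range_add]
  have : (m : ℝ) ≤ ∑ k ∈ Finset.range m, b (N + k) := by
    have := Finset.card_nsmul_le_sum (Finset.range m) (fun k => b (N + k)) 1
      fun k _ => hN _ (Nat.le_add_right _ _)
    simpa using this
  linarith

/-! ### Consequences of the covariance conditions. -/

section Assumptions

variable {Ω : Type*} {mΩ : MeasurableSpace Ω} {P : Measure Ω} {T : ℝ} {X : ℝ → Ω → ℝ}

/-- Increments with positive variance have a nondegenerate Gaussian law. -/
lemma IsCenteredContGaussian.exists_law (hX : IsCenteredContGaussian P T X) {s t : ℝ}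
    (hs : s ∈ Icc 0 T) (ht : t ∈ Icc 0 T) (hpos : 0 < incVar P X t s) :
    ∃ m : ℝ, ∃ v : NNReal, v ≠ 0 ∧ P.map (fun ω => X t ω - X s ω) = gaussianReal m v := by
  have hg : HasGaussianLaw (fun ω => X t ω - X s ω) P :=
    hX.gaussian.hasGaussianLaw_fun_sub (s := ⟨t, ht⟩) (t := ⟨s, hs⟩)
  refine ⟨_, _, ?_, hg.map_eq_gaussianReal⟩
  have h0 : ∫ ω, (X t ω - X s ω) ∂P = 0 := by
    rw [integral_sub (hX.gaussian.hasGaussianLaw_eval ⟨t, ht⟩).integrable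
      (hX.gaussian.hasGaussianLaw_eval ⟨s, hs⟩).integrable, hX.centered t ht, hX.centered s hs,
      sub_zero]
  rw [variance_of_integral_eq_zero hg.aemeasurable h0]
  exact (Real.toNNReal_pos.2 hpos).ne'

lemma IsCenteredContGaussian.integrable_sq (hX : IsCenteredContGaussian P T X) {s t : ℝ}
    (hs : s ∈ Icc 0 T) (ht : t ∈ Icc 0 T) : Integrable (fun ω => (X t ω - X s ω) ^ 2) P := by
  have hg : HasGaussianLaw (fun ω => X t ω - X s ω) P :=
    hX.gaussian.hasGaussianLaw_fun_sub (s := ⟨t, ht⟩) (t := ⟨s, hs⟩)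
  exact hg.memLp_two.integrable_sq

/-- The diagonal case of the positivity condition for the process started at `s`. -/
lemma CovConditions.incVar_pos {α s t : ℝ} (h : CovConditions P α (T - s) (incr X s))
    (hst : s < t) (ht : t ≤ T) : 0 < incVar P X t s := by
  have := h.pos (t - s) ⟨by linarith, by linarith⟩ (t - s) ⟨by linarith, by linarith⟩
  simpa only [covR, incr, sub_add_cancel, incVar, sq] using this

/-- Condition `upper` for the process started at `a` alone covers all increments within `[a, T]`,
with the exponent `2α = 1 + κ`. -/
lemma CovConditions.incrementBound {α a : ℝ} (h : CovConditions P α (T - a) (incr X a))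
    (hX : IsCenteredContGaussian P T X) (ha : 0 ≤ a) (hm : ∀ t ∈ Icc 0 T, Measurable (X t)) :
    ∃ C, IncrementBound P X a T C (2 * α - 1) := by
  have hsub : Icc a T ⊆ Icc 0 T := Icc_subset_Icc_left ha
  obtain ⟨C, -, hb⟩ := h.upper
  refine ⟨C, fun t ht => hm t (hsub ht), fun s hs t ht =>
    hX.integrable_sq (hsub hs) (hsub ht), fun s hs t ht hst => ?_⟩
  have := hb (t - s) ⟨by linarith, by linarith [hs.1, ht.2]⟩ (s - a)
    ⟨by linarith [hs.1], by linarith [ht.2]⟩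
  rw [show 1 + (2 * α - 1) = 2 * α by ring]
  simpa only [incVar, incr, sub_sub_sub_cancel_right, sub_add_sub_cancel, sub_add_cancel] using this

end Assumptions

end GaussRep

end

/-! ### Assembly of the strategy. -/

theorem corollary3p1 {Ω : Type*} {mΩ : MeasurableSpace Ω} (P : Measure Ω) [IsProbabilityMeasure P]
    (T α : ℝ) (hT : 0 < T) (hα : 1 / 2 < α) (hα1 : α < 1)
    (𝓕 : Filtration (Icc (0 : ℝ) T) mΩ)
    (X : ℝ → Ω → ℝ) (hadapted : ∀ t : Icc (0 : ℝ) T, Measurable[𝓕 t] (X t))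
    (hX : GaussRep.InClassX P α T X) (hball : GaussRep.SmallBall P α T X)
    (F : ℝ → ℝ) (hF : GaussRep.IsDistributionFunction F) :
    ∃ ψ : ℝ → Ω → ℝ, (∀ t : Icc (0 : ℝ) T, Measurable[𝓕 t] (ψ t)) ∧
      ∃ β : ℝ, ∃ ξ : Ω → ℝ, Measurable ξ ∧
        (∀ᵐ ω ∂P, GaussRep.HasGLSIntegral β T (fun s => ψ s ω) (fun s => X s ω) (ξ ω)) ∧
        ∀ x : ℝ, P.real {ω | ξ ω ≤ x} = F x := by
  obtain ⟨δ, hδ, hδT, hcov⟩ := hX.local_cov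
  set a := T - δ with ha
  have ha0 : 0 ≤ a := by linarith
  have haT : a < T := by linarith
  have hmX : ∀ t ∈ Icc 0 T, Measurable (X t) := fun t ht =>
    (hadapted ⟨t, ht⟩).mono (𝓕.le _) le_rfl
  have hκ : 0 < 2 * α - 1 := by linarith
  obtain ⟨C, hb⟩ := (hcov a ⟨le_rfl, haT⟩).incrementBound hX.base ha0 hmX
  have hlaw : ∀ s ∈ Ico a T, ∀ t, s < t → t ≤ T →
      ∃ m : ℝ, ∃ v : NNReal, v ≠ 0 ∧ P.map (fun ω => X t ω - X s ω) = gaussianReal m v :=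
    fun s hs t hst ht => hX.base.exists_law ⟨ha0.trans hs.1, hs.2.le⟩
      ⟨ha0.trans (hs.1.trans hst.le), ht⟩ ((hcov s hs).incVar_pos hst ht)
  have hnull : ∀ s ∈ Ico a T, ∀ t, s < t → t ≤ T → P {ω | X t ω = X s ω} = 0 := by
    intro s hs t hst ht
    obtain ⟨m, v, hv, h⟩ := hlaw s hs t hst ht
    have := nullSingletonClass_gaussianReal (μ := m) hv
    have h0 := measure_singleton (μ := gaussianReal m v) 0
    have hmD : Measurable fun ω => X t ω - X s ω :=
      (hmX t ⟨ha0.trans (hs.1.trans hst.le), ht⟩).sub (hmX s ⟨ha0.trans hs.1, hs.2.le⟩)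
    rw [← h, Measure.map_apply hmD (measurableSet_singleton 0)] at h0
    rw [← h0]
    congr 1
    ext ω
    exact sub_eq_zero.symm
  -- The blocks accumulate at `T`. The offset 2 puts `u 0` strictly after `a`, which leaves `[a, u
  -- 0]` for the construction of `G`.
  let u : ℕ → ℝ := fun k => T - δ / ((k : ℝ) + 2)
  have huT : ∀ k, u k < T := fun k => sub_lt_self _ (by positivity)
  have hus : StrictMono u := by
    refine strictMono_nat_of_lt_succ fun k => sub_lt_sub_left ?_ T
    push_cast
    gcongr
    linarith
  have hu := hus.monotone
  have hau : a < u 0 := by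
    simp only [u, ha]
    push_cast
    linarith
  have hu0 : 0 ≤ u 0 := ha0.trans hau.le
  have huI : ∀ k, u k ∈ Ico a T := fun k => ⟨hau.le.trans (hu (Nat.zero_le k)), huT k⟩
  obtain ⟨η, hη, hηsum⟩ := ENNReal.exists_pos_sum_of_countable' (ε := 1) one_ne_zero ℕ
  have hblock := fun k => hb.exists_riemannSum hκ ⟨(huI k).1, (huI k).2.le⟩
    ⟨(huI (k + 1)).1, (huI (k + 1)).2.le⟩ (hus (Nat.lt_succ_self k))
    (hnull _ (huI k) _ (hus (Nat.lt_succ_self k)) (huT (k + 1)).le) (hη k)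
  choose n hn c hc using hblock
  obtain ⟨m, v, hv, hlaw0⟩ := hlaw a ⟨le_rfl, haT⟩ (u 0) hau (huT 0).le
  have hu0T : u 0 ∈ Icc 0 T := ⟨hu0, (huT 0).le⟩
  have haI : a ∈ Icc 0 T := ⟨ha0, haT.le⟩
  obtain ⟨g, hg, hgF⟩ := GaussRep.exists_transport ((hmX _ hu0T).sub (hmX _ haI)) hv hlaw0 hF
  let G : Ω → ℝ := fun ω => g (X (u 0) ω - X a ω)
  let N : ℝ → ℕ := fun t => ⌈δ / (T - t)⌉₊
  have hN : ∀ t < T, t ≤ u (N t) := by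
    intro t ht
    have h0 : 0 < T - t := sub_pos.2 ht
    have h1 : δ / (T - t) ≤ (N t : ℝ) + 2 := (Nat.le_ceil _).trans (by linarith)
    have h2 : δ / ((N t : ℝ) + 2) ≤ T - t := by
      rw [div_le_iff₀ h0] at h1
      rw [div_le_iff₀ (by positivity)]
      linarith
    simp only [u]
    linarith
  have hXF : ∀ t (ht : t ∈ Icc 0 T), ∀ s ∈ Icc 0 t, Measurable[𝓕 ⟨t, ht⟩] (X s) :=
    fun t ht s hs => (hadapted ⟨s, hs.1, hs.2.trans ht.2⟩).mono (𝓕.mono hs.2) le_rfl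
  -- With `κ = 2α - 1`, the paths are Hölder of order `κ / 4`. The order `1 - β = κ / 8` lies
  -- strictly below it, and does not depend on the path.
  refine ⟨GaussRep.strategy X u n c N G, fun t => ?_, 1 - (2 * α - 1) / 8, G,
    hg.comp ((hmX _ hu0T).sub (hmX _ haI)), ?_, hgF⟩
  · refine GaussRep.measurable_strategy hu hu0 (hXF t t.2) N fun h => hg.comp ?_
    exact (hXF t t.2 _ ⟨hu0, h⟩).sub (hXF t t.2 _ ⟨ha0, hau.le.trans h⟩)
  · have hcX := hX.base.continuous
    -- Borel–Cantelli: almost surely all but finitely many blocks gain at least one.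
    have hev := ae_eventually_notMem (μ := P)
      (ne_top_of_le_ne_top (hηsum.trans ENNReal.one_lt_top).ne (ENNReal.tsum_le_tsum hc))
    filter_upwards [hb.ae_holder haT hκ fun ω => (hcX ω).mono (Icc_subset_Icc_left ha0), hev]
      with ω ⟨K, hK, hKX⟩ hω
    obtain ⟨M, hM⟩ := GaussRep.exists_lt_sum_range (hω.mono fun k hk => not_lt.1 hk) |G ω|
    refine GaussRep.hasGLSIntegral_strategy (γ := (2 * α - 1) / 4) (M := M)
      ⟨by linarith, by linarith⟩ (by linarith) hK ha0 hu hau.le huT hN (hcX ω) hKX ?_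
    rw [GaussRep.gain_end hu hn]
    exact hM
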